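/- Let $d\ge 1$. Let $\mathcal S'(\mathbb R^d)$ be the space of complex tempered distributions and $\mathcal F$ the Fourier transform, $\mathcal F\theta(\xi)=(2\pi)^{-d/2}\int_{\mathbb R^d}e^{ix\xi}\theta(x)\,dx$ for Schwartz functions $\theta$, extended to $\mathcal S'(\mathbb R^d)$. Let $\phi_0\in C_0^\infty(\mathbb R^d)$ be non-negative with $\phi_0(x)=1$ for $|x|\le 1$ and $\phi_0(x)=0$ for $|x|\ge \frac32$, and put $\phi_j(x)=\phi_0(2^{-j}x)-\phi_0(2^{-j+1}x)$ for $j\ge 1$. For $t\in\mathbb R$ and $0<p,q\le\infty$ the isotropic Besov space $B^t_{p,q}(\mathbb R^d)$ consists of all $f\in\mathcal S'(\mathbb R^d)$ with $$\|f|B^t_{p,q}(\mathbb R^d)\|=\Big(\sum_{j=0}^\infty 2^{jtq}\,\big\|\mathcal F^{-1}[\phi_j\mathcal F f]\,\big|L_p(\mathbb R^d)\big\|^q\Big)^{1/q}<\infty$$ (supremum if $q=\infty$). Let $\varphi_0\in C_0^\infty(\mathbb R)$ be complex-valued with $\varphi_0=1$ on $[-1,1]$ and $\operatorname{supp}\varphi_0\subset[-\frac32,\frac32]$,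 put $\varphi_j(x)=\varphi_0(2^{-j}x)-\varphi_0(2^{-j+1}x)$ for $j\ge1$, and $\varphi_{\bar k}(x)=\varphi_{k_1}(x_1)\cdots\varphi_{k_d}(x_d)$ for $\bar k\in\mathbb N_0^d$. The Besov space of dominating mixed smoothness $S^t_{p,q}B(\mathbb R^d)$ consists of all $f\in\mathcal S'(\mathbb R^d)$ with $$\|f|S^t_{p,q}B(\mathbb R^d)\|=\Big(\sum_{\bar k\in\mathbb N_0^d} 2^{(k_1+\dots+k_d)tq}\,\big\|\mathcal F^{-1}[\varphi_{\bar k}\mathcal F f]\,\big|L_p(\mathbb R^d)\big\|^q\Big)^{1/q}<\infty$$ (supremum if $q=\infty$). We write $X\hookrightarrow Y$ if $X\subset Y$ and the inclusion is continuous, i.e. $\|f|Y\|\le C\|f|X\|$ for all $f\in X$, with a constant $C$ independent of $f$. **Theorem.** Fix $0<p,q\le\infty$ and $t\in\mathbb R$. Within all spaces $S^{t_0}_{p_0,q_0}B(\mathbb R^d)$, $0<p_0,q_0\le\infty$, $t_0\in\mathbb R$, satisfying $$B^{td}_{p,q}(\mathbb R^d)\hookrightarrow S^{t_0}_{p_0,q_0}B(\mathbb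 R^d),$$ the class $S^t_{p,q}B(\mathbb R^d)$ is the smallest one, in the sense that for all such $t_0,p_0,q_0$ this embedding implies $$S^t_{p,q}B(\mathbb R^d)\hookrightarrow S^{t_0}_{p_0,q_0}B(\mathbb R^d).$$ (It is not asserted here that $B^{td}_{p,q}(\mathbb R^d)\hookrightarrow S^t_{p,q}B(\mathbb R^d)$, which fails for some $p,q,t$.) -/

import Mathlib

open MeasureTheory Set
open scoped ENNReal NNReal ContDiff SchwartzMap

noncomputable section

namespace BesovEmb

/-- The Euclidean space `ℝ^d`. -/
abbrev Rd (d : ℕ) : Type := EuclideanSpace ℝ (Fin d)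

/-- Generators of isotropic dyadic decompositions of unity on `ℝ^d`: smooth non-negative functions,
equal to `1` on the unit ball and vanishing for `|x| ≥ 3/2` (so they are compactly supported). -/
structure IsIsoGenerator {d : ℕ} (φ₀ : Rd d → ℝ) : Prop where
  smooth : ContDiff ℝ ∞ φ₀
  nonneg : ∀ x, 0 ≤ φ₀ x
  eq_one : ∀ x, ‖x‖ ≤ 1 → φ₀ x = 1
  eq_zero : ∀ x, 3 / 2 ≤ ‖x‖ → φ₀ x = 0

/-- Generators of dyadic decompositions of unity on `ℝ`: smooth complex-valued functions, equal
to `1` on `[-1, 1]` and supported in `[-3/2, 3/2]`. -/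
structure IsUnivGenerator (φ₀ : ℝ → ℂ) : Prop where
  smooth : ContDiff ℝ ∞ φ₀
  eq_one : ∀ x ∈ Icc (-1 : ℝ) 1, φ₀ x = 1
  supp : tsupport φ₀ ⊆ Icc (-(3 / 2) : ℝ) (3 / 2)

/-- The dyadic decomposition of unity generated by `φ₀`: its member number `0` is `φ₀`, and its
member number `j ≥ 1` is `x ↦ φ₀ (2^{-j} x) - φ₀ (2^{-j+1} x)`. -/
def dyadic {E : Type*} [SMul ℝ E] (φ₀ : E → ℂ) (j : ℕ) (x : E) : ℂ :=
  if j = 0 then φ₀ x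
  else φ₀ ((2 : ℝ) ^ (-(j : ℤ)) • x) - φ₀ ((2 : ℝ) ^ (-(j : ℤ) + 1) • x)

/-- The tensor product decomposition `φ_{k_1}(x_1) ⋯ φ_{k_d}(x_d)` of unity on `ℝ^d`. -/
def dyadicTensor {d : ℕ} (φ₀ : ℝ → ℂ) (k : Fin d → ℕ) (x : Rd d) : ℂ :=
  ∏ i, dyadic φ₀ (k i) (x i)

/-- The tempered distribution `F⁻¹[m · F f]`, where `F` is the Fourier transform normalised by
`F θ(ξ) = (2π)^{-d/2} ∫ e^{i⟨x, ξ⟩} θ(x) dx`. In terms of Mathlib's Fourier transform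
`𝓕 θ(ξ) = ∫ e^{-2πi⟨x, ξ⟩} θ(x) dx` one has `F θ(ξ) = (2π)^{-d/2} 𝓕 θ(-ξ/(2π))`, and the
substitution `ξ = -2π η` gives `F⁻¹[m · F f] = 𝓕⁻¹[m(-2π ·) · 𝓕 f]`. -/
def block {d : ℕ} (m : Rd d → ℂ) (f : 𝓢'(Rd d, ℂ)) : 𝓢'(Rd d, ℂ) :=
  TemperedDistribution.fourierMultiplierCLM ℂ (fun η => m ((-(2 * Real.pi)) • η)) f

/-- The tempered distribution `T` is (integration against) the function `g`. -/
def IsGivenBy {d : ℕ} (T : 𝓢'(Rd d, ℂ)) (g : Rd d → ℂ) : Prop :=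
  AEStronglyMeasurable g volume ∧
    ∀ θ : 𝓢(Rd d, ℂ), Integrable (fun x => θ x * g x) volume ∧ T θ = ∫ x, θ x * g x

/-- The (quasi-)norm in `L_p(ℝ^d)`, `0 < p ≤ ∞`, of a tempered distribution: that of the function
(unique up to null sets) by which it is given, and `∞` if it is not given by a function. -/
def distLpNorm {d : ℕ} (p : ℝ≥0∞) (T : 𝓢'(Rd d, ℂ)) : ℝ≥0∞ :=
  ⨅ (g : Rd d → ℂ) (_ : IsGivenBy T g), eLpNorm g p volume

/-- The `ℓ_q` (quasi-)norm, `0 < q ≤ ∞`, of a family of numbers in `[0, ∞]`. -/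
def ellqNorm {I : Type*} (q : ℝ≥0∞) (a : I → ℝ≥0∞) : ℝ≥0∞ :=
  if q = ⊤ then ⨆ k, a k else (∑' k, a k ^ q.toReal) ^ (1 / q.toReal)

/-- The quasi-norm of the isotropic Besov space `B^t_{p,q}(ℝ^d)`, with value `∞` outside the
space. -/
def isoBesovNorm {d : ℕ} (φ₀ : Rd d → ℝ) (t : ℝ) (p q : ℝ≥0∞) (f : 𝓢'(Rd d, ℂ)) : ℝ≥0∞ :=
  ellqNorm q fun j : ℕ =>
    (2 : ℝ≥0∞) ^ ((j : ℝ) * t) *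
      distLpNorm p (block (dyadic (fun x => (φ₀ x : ℂ)) j) f)

/-- The quasi-norm of the Besov space of dominating mixed smoothness `S^t_{p,q}B(ℝ^d)`, with
value `∞` outside the space. -/
def mixedBesovNorm {d : ℕ} (φ₀ : ℝ → ℂ) (t : ℝ) (p q : ℝ≥0∞) (f : 𝓢'(Rd d, ℂ)) : ℝ≥0∞ :=
  ellqNorm q fun k : Fin d → ℕ =>
    (2 : ℝ≥0∞) ^ (((∑ i, k i : ℕ) : ℝ) * t) * distLpNorm p (block (dyadicTensor φ₀ k) f)

/-- The space of tempered distributions on which an extended quasi-norm is finite. -/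
def finiteSpace {d : ℕ} (N : 𝓢'(Rd d, ℂ) → ℝ≥0∞) : Set 𝓢'(Rd d, ℂ) := {f | N f < ⊤}

/-- The continuous embedding `X ↪ Y` of the quasi-normed spaces `X = {N < ∞}`, `Y = {M < ∞}` of
tempered distributions: `X ⊆ Y`, and the inclusion, being linear, is continuous iff bounded. -/
def ContEmbeds {d : ℕ} (N M : 𝓢'(Rd d, ℂ) → ℝ≥0∞) : Prop :=
  finiteSpace N ⊆ finiteSpace M ∧ ∃ C : ℝ≥0, ∀ f ∈ finiteSpace N, M f ≤ C * N f

end BesovEmb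

end

/-! The assumed embedding is used only on test functions. These force three conditions: `p ≤ p₀`;
`t₀ - 1/p₀ ≤ t - 1/p`; and `q ≤ q₀` when equality holds in the second. The same conditions suffice
for the embedding between the two mixed spaces.

Necessity. A Schwartz function with spectrum near the origin meets only the zeroth block of either
decomposition, so its quasi-norms are its `L_p` and `L_{p₀}` quasi-norms; dilating it by `2^{-l}`
gives `p ≤ p₀` (`one_div_le_of_contEmbeds`). Next, `S` is chosen so that its dilate by `2^j` has
spectrum in the isotropic block `j` and in a single mixed block `k` with `|k| = k_1 + ... + k_d = jd
- const`. On such nearly diagonal blocks the weights `2^{jtd}` and `2^{|k|t}` agree up to a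
constant, which explains the smoothness `td`. Both quasi-norms of a sum of normalised dilates are
then explicit (`exists_lacunary_estimate`): single levels give the second condition, many levels the
third.

Sufficiency. A mixed block has spectrum in a box of volume about `2^{|k|}`, so by Nikolskii's
inequality (`exists_distLpNorm_block_le`) passing from `L_p` to `L_{p₀}` costs a factor `2^{|k|(1/p
- 1/p₀)}`. What remains is a comparison of sequence norms (`contEmbeds_mixedBesovNorm`). -/

noncomputable section

namespace BesovEmb

open FourierTransform Filter Topology

/-! ### Dyadic decompositions of unity and their symbols. -/

section Dyadic

variable {E : Type*} [NormedAddCommGroup E] [NormedSpace ℝ E]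

/-- For `m ≥ n` the point `2^{-m} x` lies in the unit ball, and for `m < n` its norm exceeds `2 *
(3/4) = 3/2`. The values of `φ` thus jump from 0 to 1 exactly at `m = n`, and only the difference
across this jump survives. -/
theorem dyadic_eq_ite {φ : E → ℂ} (h1 : ∀ x, ‖x‖ ≤ 1 → φ x = 1) (h0 : ∀ x, 3 / 2 < ‖x‖ → φ x = 0)
    {n : ℕ} {x : E} (hx : ‖x‖ ≤ 2 ^ n) (hx' : n = 0 ∨ 3 / 4 * 2 ^ n < ‖x‖) (j : ℕ) :
    dyadic φ j x = if j = n then 1 else 0 := by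
  have hnorm (m : ℤ) : ‖(2 : ℝ) ^ m • x‖ = 2 ^ m * ‖x‖ := by
    rw [norm_smul, Real.norm_of_nonneg (by positivity)]
  have key (m : ℤ) (hm : (n : ℤ) ≤ m) : φ ((2 : ℝ) ^ (-m) • x) = 1 := by
    apply h1
    rw [hnorm]
    calc (2 : ℝ) ^ (-m) * ‖x‖ ≤ 2 ^ (-m) * 2 ^ n := by gcongr
      _ = 2 ^ (-m + n) := by rw [zpow_add₀ two_ne_zero, zpow_natCast]
      _ ≤ 1 := zpow_le_one_of_nonpos₀ one_le_two (by lia)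
  have key0 (m : ℤ) (hn : n ≠ 0) (hm : m < n) : φ ((2 : ℝ) ^ (-m) • x) = 0 := by
    apply h0
    rw [hnorm]
    have hx'' := hx'.resolve_left hn
    calc (3 / 2 : ℝ) = 3 / 4 * 2 ^ (1 : ℤ) := by norm_num
      _ ≤ 3 / 4 * 2 ^ (-m + n) := by
        gcongr
        · norm_num
        · lia
      _ = 2 ^ (-m) * (3 / 4 * 2 ^ n) := by rw [zpow_add₀ two_ne_zero, zpow_natCast]; ring
      _ < 2 ^ (-m) * ‖x‖ := by gcongr
  have e0 : φ x = φ ((2 : ℝ) ^ (-(0 : ℤ)) • x) := by simp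
  have e1 : -(j : ℤ) + 1 = -((j : ℤ) - 1) := by ring
  unfold dyadic
  rw [e1]
  split_ifs with hj hjn hjn
  · subst hj; rw [e0, key 0 (by lia)]
  · subst hj; rw [e0, key0 0 (by lia) (by lia)]
  · rw [key _ (by lia), key0 _ (by lia) (by lia), sub_zero]
  · rcases lt_or_gt_of_ne hjn with h | h
    · rw [key0 _ (by lia) (by lia), key0 _ (by lia) (by lia), sub_zero]
    · rw [key _ (by lia), key _ (by lia), sub_self]

theorem dyadic_eq_zero {φ : E → ℂ} (h0 : ∀ x, 3 / 2 < ‖x‖ → φ x = 0) {j : ℕ} {x : E}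
    (hx : 3 / 2 * 2 ^ j < ‖x‖) : dyadic φ j x = 0 := by
  have key (m : ℤ) (hm : m ≤ j) : φ ((2 : ℝ) ^ (-m) • x) = 0 := by
    apply h0
    rw [norm_smul, Real.norm_of_nonneg (by positivity)]
    calc (3 / 2 : ℝ) = 3 / 2 * 2 ^ (0 : ℤ) := by norm_num
      _ ≤ 3 / 2 * 2 ^ (-m + j) := by
        gcongr
        · norm_num
        · lia
      _ = 2 ^ (-m) * (3 / 2 * 2 ^ j) := by rw [zpow_add₀ two_ne_zero, zpow_natCast]; ring
      _ < 2 ^ (-m) * ‖x‖ := by gcongr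
  have e0 : φ x = φ ((2 : ℝ) ^ (-(0 : ℤ)) • x) := by simp
  have e1 : -(j : ℤ) + 1 = -((j : ℤ) - 1) := by ring
  unfold dyadic
  rw [e1, e0, key 0 (by lia), key j le_rfl, key _ (by lia)]
  simp

theorem contDiff_dyadic {φ : E → ℂ} (hφ : ContDiff ℝ ∞ φ) (j : ℕ) : ContDiff ℝ ∞ (dyadic φ j) := by
  unfold dyadic
  split_ifs
  · exact hφ
  · fun_prop

end Dyadic

theorem IsUnivGenerator.eq_zero {ϕ : ℝ → ℂ} (h : IsUnivGenerator ϕ) (x : ℝ) (hx : 3 / 2 < ‖x‖) :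
    ϕ x = 0 := by
  by_contra hne
  have := h.supp (subset_tsupport _ hne)
  rw [Real.norm_eq_abs, lt_abs] at hx
  rcases hx with hx | hx <;> linarith [this.1, this.2]

theorem IsUnivGenerator.eq_one' {ϕ : ℝ → ℂ} (h : IsUnivGenerator ϕ) (x : ℝ) (hx : ‖x‖ ≤ 1) :
    ϕ x = 1 := h.eq_one x (abs_le.mp hx)

variable {d : ℕ}

theorem dyadicTensor_eq_ite {ϕ : ℝ → ℂ} (h : IsUnivGenerator ϕ) {n : Fin d → ℕ} {x : Rd d}
    (hx : ∀ i, |x i| ≤ 2 ^ n i) (hx' : ∀ i, n i = 0 ∨ 3 / 4 * 2 ^ n i < |x i|) (k : Fin d → ℕ) :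
    dyadicTensor ϕ k x = if k = n then 1 else 0 := by
  have (i : Fin d) : dyadic ϕ (k i) (x i) = if k i = n i then 1 else 0 :=
    dyadic_eq_ite h.eq_one' h.eq_zero (hx i) (hx' i) _
  unfold dyadicTensor
  simp_rw [this]
  split_ifs with hk
  · subst hk; simp
  · obtain ⟨i, hi⟩ := Function.ne_iff.mp hk
    exact Finset.prod_eq_zero (Finset.mem_univ i) (by simp [hi])

theorem dyadicTensor_eq_zero {ϕ : ℝ → ℂ} (h : IsUnivGenerator ϕ) {k : Fin d → ℕ} {x : Rd d}
    {i : Fin d} (hx : 3 / 2 * 2 ^ k i < |x i|) : dyadicTensor ϕ k x = 0 :=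
  Finset.prod_eq_zero (Finset.mem_univ i) (dyadic_eq_zero h.eq_zero hx)

theorem norm_le_sum_abs (x : Rd d) : ‖x‖ ≤ ∑ i, |x i| := by
  conv_lhs => rw [← (EuclideanSpace.basisFun (Fin d) ℝ).sum_repr x]
  refine (norm_sum_le _ _).trans (le_of_eq ?_)
  simp [norm_smul]

/-- The symbol of `block m` with respect to Mathlib's Fourier transform. -/
abbrev symb (m : Rd d → ℂ) (η : Rd d) : ℂ := m ((-(2 * Real.pi)) • η)

/-- The multiplier identities used below need a symbol of temperate growth; compact support provides
it. -/
theorem hasTemperateGrowth_symb {m : Rd d → ℂ} (hm : ContDiff ℝ ∞ m) {R : ℝ}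
    (h0 : ∀ x, R < ‖x‖ → m x = 0) : (symb m).HasTemperateGrowth := by
  have hc : HasCompactSupport (symb m) := by
    refine HasCompactSupport.intro (isCompact_closedBall (0 : Rd d) R) fun x hx => h0 _ ?_
    rw [mem_closedBall_zero_iff, not_le] at hx
    rw [norm_smul, norm_neg, Real.norm_of_nonneg (by positivity)]
    have : 1 ≤ 2 * Real.pi := by linarith [Real.pi_gt_three]
    nlinarith [norm_nonneg x]
  exact hc.hasTemperateGrowth (by unfold symb; fun_prop)

theorem IsIsoGenerator.eq_zero' {φ : Rd d → ℝ} (h : IsIsoGenerator φ) (x : Rd d)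
    (hx : 3 / 2 < ‖x‖) : (φ x : ℂ) = 0 := by simp [h.eq_zero x hx.le]

theorem hasTemperateGrowth_symb_dyadic {φ : Rd d → ℝ} (h : IsIsoGenerator φ) (j : ℕ) :
    (symb (dyadic (fun x => (φ x : ℂ)) j)).HasTemperateGrowth :=
  hasTemperateGrowth_symb (contDiff_dyadic (Complex.ofRealCLM.contDiff.comp h.smooth) j)
    fun _ hx => dyadic_eq_zero h.eq_zero' hx

theorem hasTemperateGrowth_symb_dyadicTensor {ϕ : ℝ → ℂ} (h : IsUnivGenerator ϕ) (k : Fin d → ℕ) :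
    (symb (dyadicTensor (d := d) ϕ k)).HasTemperateGrowth := by
  refine hasTemperateGrowth_symb (R := ∑ i, 3 / 2 * 2 ^ k i) ?_ fun x hx => ?_
  · unfold dyadicTensor
    refine contDiff_prod fun i _ => (contDiff_dyadic h.smooth (k i)).comp ?_
    exact (EuclideanSpace.proj (𝕜 := ℝ) i).contDiff
  · by_contra hne
    have hle (i : Fin d) : |x i| ≤ 3 / 2 * 2 ^ k i := by
      by_contra! hlt
      exact hne (dyadicTensor_eq_zero h hlt)
    linarith [norm_le_sum_abs x, Finset.sum_le_sum fun i (_ : i ∈ Finset.univ) => hle i]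

/-! ### Anisotropic dilations: effect on integrals, norms and Fourier transforms. -/

/-- The dyadic anisotropic dilation `x ↦ (2 ^ n_i x_i)_i`. -/
def dil (n : Fin d → ℤ) : Rd d ≃L[ℝ] Rd d :=
  LinearEquiv.toContinuousLinearEquiv
    { toFun := fun x => WithLp.toLp 2 fun i => (2 : ℝ) ^ n i * x i
      invFun := fun x => WithLp.toLp 2 fun i => (2 : ℝ) ^ (-n i) * x i
      map_add' := fun x y => by ext i; simp [mul_add]
      map_smul' := fun c x => by ext i; simp; ring
      left_inv := fun x => by ext i; simp [zpow_neg, zpow_ne_zero]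
      right_inv := fun x => by ext i; simp [zpow_neg, zpow_ne_zero] }

@[simp] theorem dil_apply (n : Fin d → ℤ) (x : Rd d) (i : Fin d) :
    dil n x i = (2 : ℝ) ^ n i * x i := rfl

@[simp] theorem dil_neg_dil (n : Fin d → ℤ) (x : Rd d) : dil (-n) (dil n x) = x := by
  ext i; simp [zpow_neg, zpow_ne_zero]

theorem dil_const (j : ℤ) (x : Rd d) : dil (fun _ => j) x = (2 : ℝ) ^ j • x := by
  ext i; simp

theorem inner_dil (n : Fin d → ℤ) (x y : Rd d) : inner ℝ (dil n x) y = inner ℝ x (dil n y) := by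
  simp only [PiLp.inner_apply, dil_apply]
  refine Finset.sum_congr rfl fun i _ => ?_
  simp; ring

theorem det_dil (n : Fin d → ℤ) :
    LinearMap.det (dil n : Rd d →ₗ[ℝ] Rd d) = (2 : ℝ) ^ (∑ i, n i) := by
  rw [← LinearMap.det_toMatrix (EuclideanSpace.basisFun (Fin d) ℝ).toBasis]
  have : LinearMap.toMatrix (EuclideanSpace.basisFun (Fin d) ℝ).toBasis
      (EuclideanSpace.basisFun (Fin d) ℝ).toBasis (dil n : Rd d →ₗ[ℝ] Rd d)
      = Matrix.diagonal fun i => (2 : ℝ) ^ n i := by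
    ext i j
    by_cases h : i = j <;> simp [LinearMap.toMatrix_apply, h]
  rw [this, Matrix.det_diagonal]
  induction (Finset.univ : Finset (Fin d)) using Finset.cons_induction with
  | empty => simp
  | cons i s hi ih => rw [Finset.prod_cons, Finset.sum_cons, ih, zpow_add₀ two_ne_zero]

theorem map_dil_volume (n : Fin d → ℤ) :
    Measure.map (dil n) (volume : Measure (Rd d)) = ENNReal.ofReal (2 ^ (-∑ i, n i)) • volume := by
  have := Measure.map_linearMap_addHaar_eq_smul_addHaar (volume : Measure (Rd d))
    (f := (dil n : Rd d →ₗ[ℝ] Rd d)) (by rw [det_dil]; positivity)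
  rw [det_dil, abs_of_pos (by positivity), ← zpow_neg] at this
  exact this

theorem integral_comp_dil (n : Fin d → ℤ) (F : Rd d → ℂ) :
    ∫ x, F (dil n x) = (2 : ℝ) ^ (-∑ i, n i) • ∫ x, F x := by
  have h := (dil n).toHomeomorph.measurableEmbedding.integral_map (μ := volume) F
  change ∫ y, F y ∂(Measure.map (dil n) volume) = ∫ x, F (dil n x) at h
  rw [← h, map_dil_volume, integral_smul_measure, ENNReal.toReal_ofReal (by positivity)]

theorem eLpNorm_comp_dil (n : Fin d → ℤ) {F : Rd d → ℂ} (hF : AEStronglyMeasurable F volume)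
    (p : ℝ≥0∞) :
    eLpNorm (fun x => F (dil n x)) p volume =
      (2 : ℝ≥0∞) ^ (-(∑ i, n i : ℤ) * (1 / p.toReal) : ℝ) * eLpNorm F p volume := by
  have hac : Measure.map (dil n) (volume : Measure (Rd d)) ≪ volume := by
    rw [map_dil_volume]; exact Measure.smul_absolutelyContinuous
  have h := eLpNorm_map_measure (p := p) (hF.mono_ac hac)
    (dil n).continuous.measurable.aemeasurable
  change _ = eLpNorm (fun x => F (dil n x)) p volume at h
  rw [← h, map_dil_volume, eLpNorm_smul_measure_of_ne_zero (by simp; positivity), smul_eq_mul]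
  congr 1
  rw [ENNReal.rpow_mul, ENNReal.toReal_div, ENNReal.toReal_one]
  congr 1
  rw [← Int.cast_neg, ← Real.rpow_intCast, ← ENNReal.ofReal_rpow_of_pos two_pos]
  simp

/-- The Schwartz function `x ↦ S (2 ^ n_i x_i)_i`. -/
def dilS (n : Fin d → ℤ) (S : 𝓢(Rd d, ℂ)) : 𝓢(Rd d, ℂ) :=
  SchwartzMap.compCLMOfContinuousLinearEquiv ℂ (dil n) S

@[simp] theorem dilS_apply (n : Fin d → ℤ) (S : 𝓢(Rd d, ℂ)) (x : Rd d) :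
    dilS n S x = S (dil n x) := rfl

theorem fourier_dilS (n : Fin d → ℤ) (S : 𝓢(Rd d, ℂ)) (ξ : Rd d) :
    𝓕 (dilS n S) ξ = (2 : ℝ) ^ (-∑ i, n i) • 𝓕 S (dil (-n) ξ) := by
  rw [SchwartzMap.fourier_coe, SchwartzMap.fourier_coe, Real.fourier_eq, Real.fourier_eq,
    ← integral_comp_dil]
  refine integral_congr_ae (.of_forall fun v => ?_)
  simp only [← inner_dil, dil_neg_dil, dilS_apply]

theorem eLpNorm_dilS (n : Fin d → ℤ) (S : 𝓢(Rd d, ℂ)) (p : ℝ≥0∞) :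
    eLpNorm (dilS n S) p volume =
      (2 : ℝ≥0∞) ^ (-(∑ i, n i : ℤ) * (1 / p.toReal) : ℝ) * eLpNorm S p volume :=
  eLpNorm_comp_dil n S.continuous.aestronglyMeasurable p

/-! ### Schwartz functions with prescribed spectrum. -/

theorem fourierInv_eq_fourier_neg_apply (S : 𝓢(Rd d, ℂ)) (x : Rd d) : 𝓕⁻ S x = 𝓕 S (-x) := by
  rw [SchwartzMap.fourierInv_coe, SchwartzMap.fourier_coe, Real.fourierInv_eq_fourier_neg]

/-- There is a Schwartz function, not vanishing at the origin, whose Fourier transform is supported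
in a given nonempty open set. -/
theorem exists_schwartz_fourier_support {U : Set (Rd d)} (hU : IsOpen U) (hne : U.Nonempty) :
    ∃ S : 𝓢(Rd d, ℂ), S 0 ≠ 0 ∧ ∀ ξ, 𝓕 S ξ ≠ 0 → ξ ∈ U := by
  obtain ⟨c, hc⟩ := hne
  obtain ⟨r, hr, hrU⟩ := Metric.isOpen_iff.mp hU c hc
  let b : ContDiffBump c := ⟨r / 2, r, by positivity, by linarith⟩
  have hcs : HasCompactSupport (fun x => (b x : ℂ)) :=
    b.hasCompactSupport.comp_left (g := fun r : ℝ => (r : ℂ)) (by simp)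
  let u : 𝓢(Rd d, ℂ) := hcs.toSchwartzMap (Complex.ofRealCLM.contDiff.comp b.contDiff)
  have hu (x : Rd d) : u x = (b x : ℂ) := rfl
  refine ⟨𝓕⁻ u, ?_, fun ξ hξ => hrU ?_⟩
  · rw [fourierInv_eq_fourier_neg_apply, SchwartzMap.fourier_coe, Real.fourier_eq]
    simp only [hu, neg_zero, inner_zero_right, AddChar.map_zero_eq_one, one_smul]
    rw [integral_complex_ofReal]
    exact_mod_cast b.integral_pos.ne'
  · rw [FourierTransform.fourier_fourierInv_eq, hu] at hξ
    have : ξ ∈ Function.support b := by simpa using hξ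
    rwa [b.support_eq] at this

theorem eLpNorm_schwartz_ne_zero {S : 𝓢(Rd d, ℂ)} (hS : S 0 ≠ 0) {p : ℝ≥0∞} (hp : p ≠ 0) :
    eLpNorm S p volume ≠ 0 := by
  rw [Ne, eLpNorm_eq_zero_iff S.continuous.aestronglyMeasurable hp]
  intro h
  have := (Continuous.ae_eq_iff_eq volume S.continuous (by fun_prop)).mp h
  exact hS (congrFun this 0)

/-- There is a Schwartz function whose Fourier transform is `1` on a given ball. -/
theorem exists_schwartz_fourier_eq_one (R : ℝ) :
    ∃ K : 𝓢(Rd d, ℂ), ∀ ξ, ‖ξ‖ ≤ R → 𝓕 K ξ = 1 := by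
  let b : ContDiffBump (0 : Rd d) := ⟨|R| + 1, |R| + 2, by positivity, by linarith⟩
  have hcs : HasCompactSupport (fun x => (b x : ℂ)) :=
    b.hasCompactSupport.comp_left (g := fun r : ℝ => (r : ℂ)) (by simp)
  let u : 𝓢(Rd d, ℂ) := hcs.toSchwartzMap (Complex.ofRealCLM.contDiff.comp b.contDiff)
  have hu (x : Rd d) : u x = (b x : ℂ) := rfl
  refine ⟨𝓕⁻ u, fun ξ hξ => ?_⟩
  rw [FourierTransform.fourier_fourierInv_eq, hu, b.one_of_mem_closedBall]
  · simp
  · rw [mem_closedBall_zero_iff]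
    change ‖ξ‖ ≤ |R| + 1
    linarith [le_abs_self R]

/-! ### Distributions given by functions, and blocks of Schwartz functions. -/

theorem IsGivenBy.locallyIntegrable {T : 𝓢'(Rd d, ℂ)} {g : Rd d → ℂ} (h : IsGivenBy T g) :
    LocallyIntegrable g volume := by
  intro x
  let b : ContDiffBump x := ⟨1, 2, by norm_num, by norm_num⟩
  have hcs : HasCompactSupport (fun x => (b x : ℂ)) :=
    b.hasCompactSupport.comp_left (g := fun r : ℝ => (r : ℂ)) (by simp)
  let u : 𝓢(Rd d, ℂ) := hcs.toSchwartzMap (Complex.ofRealCLM.contDiff.comp b.contDiff)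
  refine ⟨Metric.closedBall x 1, Metric.closedBall_mem_nhds x one_pos, ?_⟩
  refine ((h.2 u).1.integrableOn (s := Metric.closedBall x 1)).congr_fun (fun y hy => ?_)
    Metric.isClosed_closedBall.measurableSet
  have : u y = 1 := by
    change (b y : ℂ) = 1
    rw [b.one_of_mem_closedBall hy, Complex.ofReal_one]
  simp [this]

theorem ae_eq_of_integral_schwartz {g h : Rd d → ℂ} (hg : LocallyIntegrable g volume)
    (hh : LocallyIntegrable h volume)
    (H : ∀ θ : 𝓢(Rd d, ℂ), ∫ x, θ x * g x = ∫ x, θ x * h x) : g =ᵐ[volume] h := by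
  refine ae_eq_of_integral_contDiff_smul_eq hg hh fun b hb hbc => ?_
  have hcs : HasCompactSupport (fun x => (b x : ℂ)) :=
    hbc.comp_left (g := fun r : ℝ => (r : ℂ)) (by simp)
  have := H (hcs.toSchwartzMap (Complex.ofRealCLM.contDiff.comp hb))
  simp only [Complex.real_smul]
  exact this

/-- Functions giving the same distribution agree almost everywhere. -/
theorem IsGivenBy.ae_eq {T : 𝓢'(Rd d, ℂ)} {g h : Rd d → ℂ} (hg : IsGivenBy T g)
    (hh : IsGivenBy T h) : g =ᵐ[volume] h :=
  ae_eq_of_integral_schwartz hg.locallyIntegrable hh.locallyIntegrable fun θ => by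
    rw [← (hg.2 θ).2, (hh.2 θ).2]

theorem IsGivenBy.distLpNorm_eq {T : 𝓢'(Rd d, ℂ)} {g : Rd d → ℂ} (hg : IsGivenBy T g)
    (p : ℝ≥0∞) : distLpNorm p T = eLpNorm g p volume := by
  refine le_antisymm (iInf₂_le g hg) (le_iInf₂ fun h hh => ?_)
  rw [eLpNorm_congr_ae (hg.ae_eq hh)]

theorem isGivenBy_coe (S : 𝓢(Rd d, ℂ)) : IsGivenBy (S : 𝓢'(Rd d, ℂ)) S := by
  refine ⟨S.continuous.aestronglyMeasurable, fun θ => ⟨?_, ?_⟩⟩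
  · exact (SchwartzMap.pairing (ContinuousLinearMap.mul ℂ ℂ) θ S).integrable
  · simp

theorem distLpNorm_coe (p : ℝ≥0∞) (S : 𝓢(Rd d, ℂ)) :
    distLpNorm p (S : 𝓢'(Rd d, ℂ)) = eLpNorm S p volume := (isGivenBy_coe S).distLpNorm_eq p

theorem distLpNorm_zero (p : ℝ≥0∞) : distLpNorm p (0 : 𝓢'(Rd d, ℂ)) = 0 := by
  have := distLpNorm_coe p (0 : 𝓢(Rd d, ℂ))
  simpa using this

/-- A symbol equal to the constant `c` on the spectrum of a Schwartz function acts on it as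
multiplication by `c`. -/
theorem block_coe {m : Rd d → ℂ} (hm : (symb m).HasTemperateGrowth) {S : 𝓢(Rd d, ℂ)} {c : ℂ}
    (h : ∀ ξ, 𝓕 S ξ ≠ 0 → symb m ξ = c) :
    block m (S : 𝓢'(Rd d, ℂ)) = ((c • S : 𝓢(Rd d, ℂ)) : 𝓢'(Rd d, ℂ)) := by
  change TemperedDistribution.fourierMultiplierCLM ℂ (symb m) _ = _
  rw [TemperedDistribution.fourierMultiplierCLM_toTemperedDistributionCLM_eq hm,
    SchwartzMap.fourierMultiplierCLM_apply]
  congr 1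
  have : SchwartzMap.smulLeftCLM ℂ (symb m) (𝓕 S) = c • 𝓕 S := by
    ext ξ
    rw [SchwartzMap.smulLeftCLM_apply_apply hm, smul_apply]
    by_cases hξ : 𝓕 S ξ = 0
    · simp [hξ]
    · rw [h ξ hξ]
  rw [this, FourierTransform.fourierInv_smul, FourierTransform.fourierInv_fourier_eq]

/-! ### Reproducing formulas and Nikolskii's inequality. -/

/-- If `K` has Fourier transform `1` near the spectrum of `E · block m f`, then that distribution
annihilates `θ - θ ⋆ K`. -/
theorem block_apply_pairing_eq_zero {m : Rd d → ℂ} (hm : (symb m).HasTemperateGrowth)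
    (f : 𝓢'(Rd d, ℂ)) {E K : 𝓢(Rd d, ℂ)}
    (hK : ∀ ξ y, symb m ξ ≠ 0 → 𝓕⁻ E y ≠ 0 → 𝓕⁻ K (ξ - y) = 1) (θ : 𝓢(Rd d, ℂ)) :
    block m f (SchwartzMap.pairing (ContinuousLinearMap.mul ℂ ℂ) E
      (θ - SchwartzMap.convolution (ContinuousLinearMap.mul ℂ ℂ) θ K)) = 0 := by
  set R := θ - SchwartzMap.convolution (ContinuousLinearMap.mul ℂ ℂ) θ K with hR
  have hRinv (z : Rd d) : 𝓕⁻ R z = (1 - 𝓕⁻ K z) * 𝓕⁻ θ z := by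
    rw [fourierInv_eq_fourier_neg_apply, fourierInv_eq_fourier_neg_apply,
      fourierInv_eq_fourier_neg_apply, hR, sub_eq_add_neg, FourierTransform.fourier_add,
      FourierTransform.fourier_neg, SchwartzMap.fourier_convolution]
    simp
    ring
  have hconv : 𝓕⁻ (SchwartzMap.pairing (ContinuousLinearMap.mul ℂ ℂ) E R) =
      SchwartzMap.convolution (ContinuousLinearMap.mul ℂ ℂ) (𝓕⁻ E) (𝓕⁻ R) := by
    -- Convolution of Schwartz functions is by definition the inverse transform of the product of
    -- the transforms.
    change _ = 𝓕⁻ (SchwartzMap.pairing (ContinuousLinearMap.mul ℂ ℂ) (𝓕 (𝓕⁻ E)) (𝓕 (𝓕⁻ R)))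
    rw [FourierTransform.fourier_fourierInv_eq E, FourierTransform.fourier_fourierInv_eq R]
  change TemperedDistribution.fourierMultiplierCLM ℂ (symb m) f _ = 0
  rw [TemperedDistribution.fourierMultiplierCLM_apply_apply]
  have : SchwartzMap.smulLeftCLM ℂ (symb m)
      (𝓕⁻ (SchwartzMap.pairing (ContinuousLinearMap.mul ℂ ℂ) E R)) = 0 := by
    ext ξ
    rw [SchwartzMap.smulLeftCLM_apply_apply hm, hconv, SchwartzMap.convolution_apply]
    by_cases hξ : symb m ξ = 0
    · simp [hξ]
    · have : ∀ y, (𝓕⁻ E y) * (𝓕⁻ R (ξ - y)) = 0 := fun y => by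
        by_cases hy : 𝓕⁻ E y = 0
        · simp [hy]
        · rw [hRinv, hK ξ y hξ hy]; simp
      simp [MeasureTheory.convolution, this]
  rw [this, FourierTransform.fourier_zero, map_zero]

/-- A weak reproducing formula for an integrable function is a pointwise one. -/
theorem ae_eq_integral_of_weak {h : Rd d → ℂ} (hh : Integrable h volume) (K : 𝓢(Rd d, ℂ))
    (H : ∀ θ : 𝓢(Rd d, ℂ), ∫ x, θ x * h x =
      ∫ x, SchwartzMap.convolution (ContinuousLinearMap.mul ℂ ℂ) θ K x * h x) :
    h =ᵐ[volume] fun y => ∫ x, h x * K (x - y) := by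
  let Kn : Rd d → ℂ := fun z => K (-z)
  have hKn : Integrable Kn volume := K.integrable.comp_neg
  have hint := hh.convolution_integrand (ContinuousLinearMap.mul ℂ ℂ) hKn
  have hker (y x : Rd d) : Kn (y - x) = K (x - y) := by simp [Kn]
  simp only [ContinuousLinearMap.mul_apply', hker] at hint
  have hInt : Integrable (fun y => ∫ x, h x * K (x - y)) volume := by
    have := hh.integrable_convolution (ContinuousLinearMap.mul ℂ ℂ) hKn
    refine this.congr (.of_forall fun y => ?_)
    simp only [MeasureTheory.convolution_def, ContinuousLinearMap.mul_apply', hker]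
  refine ae_eq_of_integral_schwartz hh.locallyIntegrable hInt.locallyIntegrable fun θ => ?_
  -- What remains is Fubini: unfold `θ ⋆ K` and exchange the two integrals.
  rw [H]
  have e1 (x : Rd d) : SchwartzMap.convolution (ContinuousLinearMap.mul ℂ ℂ) θ K x * h x =
      ∫ y, θ y * (h x * K (x - y)) := by
    rw [SchwartzMap.convolution_apply, MeasureTheory.convolution_def, ← integral_mul_const]
    refine integral_congr_ae (.of_forall fun y => ?_)
    simp only [ContinuousLinearMap.mul_apply']
    ring
  have e2 (y : Rd d) : θ y * ∫ x, h x * K (x - y) = ∫ x, θ y * (h x * K (x - y)) :=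
    (integral_const_mul _ _).symm
  simp_rw [e1, e2]
  refine integral_integral_swap ?_
  obtain ⟨C, -, hC⟩ := θ.decay 0 0
  have h2 := hint.bdd_mul (f := fun z : Rd d × Rd d => θ z.1) (c := C)
    (θ.continuous.comp continuous_fst).aestronglyMeasurable
    (.of_forall fun z => by simpa using hC z.1)
  exact h2.swap

theorem eLpNorm_top_le_of_reproducing {h : Rd d → ℂ} (hh : AEStronglyMeasurable h volume)
    {K : 𝓢(Rd d, ℂ)} (H : h =ᵐ[volume] fun y => ∫ x, h x * K (x - y)) (r s : ℝ≥0∞)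
    [ENNReal.HolderConjugate r s] :
    eLpNorm h ⊤ volume ≤ eLpNorm h r volume * eLpNorm K s volume := by
  rw [eLpNorm_exponent_top]
  refine eLpNormEssSup_le_of_ae_enorm_bound ?_
  filter_upwards [H] with y hy
  rw [hy]
  have hmp := measurePreserving_sub_right (volume : Measure (Rd d)) y
  have hKy : eLpNorm (fun x => K (x - y)) s volume = eLpNorm K s volume :=
    eLpNorm_comp_measurePreserving K.continuous.aestronglyMeasurable hmp
  calc ‖∫ x, h x * K (x - y)‖ₑ ≤ ∫⁻ x, ‖h x * K (x - y)‖ₑ := enorm_integral_le_lintegral_enorm _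
    _ = eLpNorm (h • fun x => K (x - y)) 1 volume := by
      rw [eLpNorm_one_eq_lintegral_enorm]; rfl
    _ ≤ eLpNorm h r volume * eLpNorm (fun x => K (x - y)) s volume :=
      eLpNorm_smul_le_mul_eLpNorm (K.continuous.comp (by fun_prop)).aestronglyMeasurable hh
    _ = _ := by rw [hKy]

/-- Interpolation between `L_p` and `L_∞`. -/
theorem eLpNorm_le_top_interp {α : Type*} [MeasurableSpace α] {μ : Measure α} (h : α → ℂ)
    {p s : ℝ≥0∞} (hp : p ≠ 0) (hps : p ≤ s) (hs : s ≠ ⊤) (htop : eLpNorm h ⊤ μ ≠ ⊤) :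
    eLpNorm h s μ ≤
      eLpNorm h ⊤ μ ^ (1 - p.toReal / s.toReal) * eLpNorm h p μ ^ (p.toReal / s.toReal) := by
  have hs0 : s ≠ 0 := fun h => hp (le_zero_iff.mp (h ▸ hps))
  have hpt : p ≠ ⊤ := ne_top_of_le_ne_top hs hps
  have hp' := ENNReal.toReal_pos hp hpt
  have hs' := ENNReal.toReal_pos hs0 hs
  have hle : p.toReal ≤ s.toReal := ENNReal.toReal_mono hs hps
  set M := eLpNorm h ⊤ μ with hM
  have hbd : ∀ᵐ x ∂μ, ‖h x‖ₑ ≤ M := by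
    rw [hM, eLpNorm_exponent_top]; exact ae_le_eLpNormEssSup
  have key : ∫⁻ x, ‖h x‖ₑ ^ s.toReal ∂μ ≤
      M ^ (s.toReal - p.toReal) * ∫⁻ x, ‖h x‖ₑ ^ p.toReal ∂μ := by
    rw [← lintegral_const_mul' _ _ (ENNReal.rpow_ne_top_of_nonneg (by linarith) htop)]
    refine lintegral_mono_ae ?_
    filter_upwards [hbd] with x hx
    calc ‖h x‖ₑ ^ s.toReal = ‖h x‖ₑ ^ ((s.toReal - p.toReal) + p.toReal) := by ring_nf
      _ = ‖h x‖ₑ ^ (s.toReal - p.toReal) * ‖h x‖ₑ ^ p.toReal :=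
        ENNReal.rpow_add_of_nonneg _ _ (by linarith) hp'.le
      _ ≤ _ := by gcongr
  rw [eLpNorm_eq_lintegral_rpow_enorm_toReal hs0 hs, eLpNorm_eq_lintegral_rpow_enorm_toReal hp hpt]
  calc (∫⁻ x, ‖h x‖ₑ ^ s.toReal ∂μ) ^ (1 / s.toReal)
      ≤ (M ^ (s.toReal - p.toReal) * ∫⁻ x, ‖h x‖ₑ ^ p.toReal ∂μ) ^ (1 / s.toReal) := by gcongr
    _ = _ := by
      rw [ENNReal.mul_rpow_of_nonneg _ _ (by positivity), ← ENNReal.rpow_mul, ← ENNReal.rpow_mul]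
      congr 2 <;> field_simp

theorem eLpNorm_schwartz_ne_top (S : 𝓢(Rd d, ℂ)) (p : ℝ≥0∞) : eLpNorm S p volume ≠ ⊤ :=
  (S.eLpNorm_lt_top p volume).ne

/-- The constant in the Plancherel-Polya-Nikolskii inequality given by the kernel `K`. -/
def nikolskiiConst (p : ℝ≥0∞) (K : 𝓢(Rd d, ℂ)) : ℝ≥0∞ :=
  if p < 1 then eLpNorm K ⊤ volume ^ (1 / p.toReal) else eLpNorm K p.conjExponent volume

theorem nikolskiiConst_ne_top (p : ℝ≥0∞) (K : 𝓢(Rd d, ℂ)) : nikolskiiConst p K ≠ ⊤ := by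
  unfold nikolskiiConst
  split_ifs
  · exact ENNReal.rpow_ne_top_of_nonneg (by positivity) (eLpNorm_schwartz_ne_top K _)
  · exact (eLpNorm_schwartz_ne_top K _)

/-- For `p ≥ 1` this is Hölder's inequality in the reproducing formula. For `p < 1`, with `M` the
sup norm and `N` the `L_p` quasi-norm, the case of `L_1` and interpolation give `M ≤ κ M^{1-p} N^p`.
Dividing by `M^{1-p}` requires `M` to be finite, which follows from the integrability of `h`. -/
theorem eLpNorm_top_le_nikolskii {h : Rd d → ℂ} (hh : Integrable h volume)
    {K : 𝓢(Rd d, ℂ)} (H : h =ᵐ[volume] fun y => ∫ x, h x * K (x - y)) {p : ℝ≥0∞} (hp : p ≠ 0) :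
    eLpNorm h ⊤ volume ≤ nikolskiiConst p K * eLpNorm h p volume := by
  unfold nikolskiiConst
  split_ifs with hp1
  · have hpt : p ≠ ⊤ := (hp1.trans ENNReal.one_lt_top).ne
    have hp' := ENNReal.toReal_pos hp hpt
    have h1 := eLpNorm_top_le_of_reproducing hh.1 H 1 ⊤
    have hfin : eLpNorm h ⊤ volume ≠ ⊤ := by
      refine ne_top_of_le_ne_top (ENNReal.mul_ne_top ?_ (eLpNorm_schwartz_ne_top K ⊤)) h1
      exact (memLp_one_iff_integrable.mpr hh).2.ne
    have h2 := eLpNorm_le_top_interp h hp hp1.le ENNReal.one_ne_top hfin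
    rw [ENNReal.toReal_one, div_one] at h2
    set M := eLpNorm h ⊤ volume
    set N := eLpNorm h p volume
    set κ := eLpNorm K ⊤ volume
    by_cases hM : M = 0
    · simp [hM]
    have h3 : M ^ (1 - p.toReal) * M ^ p.toReal ≤ M ^ (1 - p.toReal) * (κ * N ^ p.toReal) := by
      rw [← ENNReal.rpow_add _ _ hM hfin, sub_add_cancel, ENNReal.rpow_one]
      calc M ≤ _ := h1
        _ ≤ M ^ (1 - p.toReal) * N ^ p.toReal * κ := by gcongr
        _ = _ := by ring
    rw [ENNReal.mul_le_mul_iff_right (by simp [ENNReal.rpow_eq_zero_iff, hM, hfin])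
      (by simp [ENNReal.rpow_eq_top_iff, hM, hfin])] at h3
    calc M = (M ^ p.toReal) ^ (1 / p.toReal) := by
          rw [← ENNReal.rpow_mul, mul_one_div_cancel hp'.ne', ENNReal.rpow_one]
      _ ≤ (κ * N ^ p.toReal) ^ (1 / p.toReal) := by gcongr
      _ = _ := by
        rw [ENNReal.mul_rpow_of_nonneg _ _ (by positivity), ← ENNReal.rpow_mul,
          mul_one_div_cancel hp'.ne', ENNReal.rpow_one]
  · have : ENNReal.HolderConjugate p p.conjExponent :=
      ENNReal.HolderConjugate.conjExponent (not_lt.mp hp1)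
    rw [mul_comm]
    exact eLpNorm_top_le_of_reproducing hh.1 H _ _

/-- The dilated kernel keeps its `L_1` norm, and its `L_s` quasi-norm scales by `2^{|n|(1 - 1/s)}`,
where `|n|` is the sum of the `n i`. Both branches of the constant then scale by `2^{|n|/p}`. -/
theorem nikolskiiConst_dilS {p : ℝ≥0∞} (hp : p ≠ 0) (hpt : p ≠ ⊤) (K : 𝓢(Rd d, ℂ)) (n : Fin d → ℤ) :
    nikolskiiConst p (((2 : ℂ) ^ (∑ i, n i)) • dilS n K) =
      (2 : ℝ≥0∞) ^ ((∑ i, n i : ℤ) * (1 / p.toReal) : ℝ) * nikolskiiConst p K := by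
  have hp' := ENNReal.toReal_pos hp hpt
  have hs (s : ℝ≥0∞) : eLpNorm (((2 : ℂ) ^ (∑ i, n i)) • dilS n K) s volume =
      (2 : ℝ≥0∞) ^ ((∑ i, n i : ℤ) * (1 - 1 / s.toReal) : ℝ) * eLpNorm K s volume := by
    have hc : ‖(2 : ℂ) ^ (∑ i, n i)‖ₑ = (2 : ℝ≥0∞) ^ ((∑ i, n i : ℤ) : ℝ) := by
      rw [← ofReal_norm, norm_zpow, Complex.norm_ofNat, ← Real.rpow_intCast,
        ← ENNReal.ofReal_rpow_of_pos two_pos]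
      simp
    change eLpNorm (((2 : ℂ) ^ (∑ i, n i)) • (dilS n K : Rd d → ℂ)) s volume = _
    rw [eLpNorm_const_smul, eLpNorm_dilS, hc, ← mul_assoc,
      ← ENNReal.rpow_add _ _ two_ne_zero ENNReal.ofNat_ne_top]
    congr 2
    ring
  unfold nikolskiiConst
  split_ifs with hp1
  · rw [hs, ENNReal.mul_rpow_of_nonneg _ _ (by positivity), ← ENNReal.rpow_mul]
    simp
  · rw [hs]
    congr 3
    have h1 : p⁻¹ ≤ 1 := ENNReal.inv_le_one.mpr (not_lt.mp hp1)
    have : p.conjExponent⁻¹ = 1 - p⁻¹ := by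
      have : ENNReal.HolderConjugate p p.conjExponent :=
        ENNReal.HolderConjugate.conjExponent (not_lt.mp hp1)
      exact (ENNReal.HolderConjugate.one_sub_inv p p.conjExponent).symm
    rw [one_div, ← ENNReal.toReal_inv, this, ENNReal.toReal_sub_of_le h1 ENNReal.one_ne_top,
      ENNReal.toReal_inv]
    simp

/-- A function with spectrum in a dyadic box satisfies a reproducing formula after multiplication
by a Schwartz function with spectrum in a small ball. -/
theorem ae_eq_integral_mul_of_block {ϕ : ℝ → ℂ} (hϕ : IsUnivGenerator ϕ) {E K : 𝓢(Rd d, ℂ)}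
    (hE : ∀ y, 𝓕 E y ≠ 0 → ‖y‖ < 1 / 2) (hK : ∀ ξ, ‖ξ‖ ≤ d → 𝓕 K ξ = 1) (k : Fin d → ℕ)
    {f : 𝓢'(Rd d, ℂ)} {g : Rd d → ℂ} (hg : IsGivenBy (block (dyadicTensor ϕ k) f) g) :
    (fun x => E x * g x) =ᵐ[volume] fun y => ∫ x, (E x * g x) *
      (((2 : ℂ) ^ (∑ i, (k i : ℤ))) • dilS (fun i => (k i : ℤ)) K) (x - y) := by
  set n : Fin d → ℤ := fun i => (k i : ℤ) with hn
  set Kk : 𝓢(Rd d, ℂ) := ((2 : ℂ) ^ (∑ i, n i)) • dilS n K with hKk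
  have hFK (ξ : Rd d) : 𝓕⁻ Kk ξ = 𝓕 K (dil (-n) (-ξ)) := by
    rw [fourierInv_eq_fourier_neg_apply, hKk, FourierTransform.fourier_smul, smul_apply,
      fourier_dilS, smul_eq_mul, Complex.real_smul, ← mul_assoc]
    push_cast
    rw [← zpow_add₀ two_ne_zero, add_neg_cancel, zpow_zero, one_mul]
  have hspec (ξ y : Rd d) (hξ : symb (dyadicTensor ϕ k) ξ ≠ 0) (hy : 𝓕⁻ E y ≠ 0) :
      𝓕⁻ Kk (ξ - y) = 1 := by
    rw [fourierInv_eq_fourier_neg_apply] at hy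
    have hy' := hE _ hy
    rw [norm_neg] at hy'
    rw [hFK]
    -- Since `2π |ξ_i| ≤ (3/2) 2^{k_i}` and `|y_i| < 1/2`, each `|ξ_i - y_i|` is at most `2^{k_i}`.
    -- The rescaled coordinates are at most 1, so the norm is at most `d`, the radius on which the
    -- transform of `K` is 1.
    refine hK _ ((norm_le_sum_abs _).trans ?_)
    calc ∑ i, |dil (-n) (-(ξ - y)) i| ≤ ∑ i : Fin d, (1 : ℝ) := by
          refine Finset.sum_le_sum fun i _ => ?_
          have h1 : |((-(2 * Real.pi)) • ξ) i| ≤ 3 / 2 * 2 ^ k i := by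
            by_contra! hlt
            exact hξ (dyadicTensor_eq_zero hϕ hlt)
          rw [PiLp.smul_apply, smul_eq_mul, abs_mul, abs_neg, abs_of_pos Real.two_pi_pos] at h1
          have h2 : |y i| ≤ ‖y‖ := by simpa using PiLp.norm_apply_le y i
          have h3 : (1 : ℝ) ≤ 2 ^ k i := one_le_pow₀ one_le_two
          have h4 : |-(ξ - y) i| ≤ 2 ^ k i := by
            rw [abs_neg, PiLp.sub_apply]
            have := abs_sub (ξ i) (y i)
            nlinarith [Real.pi_gt_three, abs_nonneg (ξ i)]
          have h5 : dil (-n) (-(ξ - y)) i = (2 ^ k i)⁻¹ * (-(ξ - y) i) := by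
            simp [hn, zpow_neg]
            ring
          rw [h5, abs_mul, abs_of_pos (by positivity), inv_mul_le_iff₀ (by positivity), mul_one]
          exact h4
      _ = d := by simp
  have hann := block_apply_pairing_eq_zero (hasTemperateGrowth_symb_dyadicTensor hϕ k) f hspec
  have hint : Integrable (fun x => E x * g x) volume := (hg.2 E).1
  refine ae_eq_integral_of_weak hint Kk fun θ => ?_
  have h0 := hann θ
  rw [map_sub, map_sub, sub_eq_zero, (hg.2 _).2, (hg.2 _).2] at h0
  have e (u : 𝓢(Rd d, ℂ)) : ∫ x, SchwartzMap.pairing (ContinuousLinearMap.mul ℂ ℂ) E u x * g x =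
      ∫ x, u x * (E x * g x) := by
    refine integral_congr_ae (.of_forall fun x => ?_)
    simp only [SchwartzMap.pairing_apply_apply, ContinuousLinearMap.mul_apply']
    ring
  rwa [e, e] at h0

/-- The Nikolskii inequality, from `L_p` to `L_∞`, for the building blocks of the spaces of
dominating mixed smoothness. -/
theorem exists_eLpNorm_top_le_of_block {ϕ : ℝ → ℂ} (hϕ : IsUnivGenerator ϕ) {p : ℝ≥0∞}
    (hp : p ≠ 0) (hpt : p ≠ ⊤) :
    ∃ C : ℝ≥0∞, C ≠ ⊤ ∧ ∀ (k : Fin d → ℕ) (f : 𝓢'(Rd d, ℂ)) (g : Rd d → ℂ),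
      IsGivenBy (block (dyadicTensor ϕ k) f) g →
      eLpNorm g ⊤ volume ≤
        C * (2 : ℝ≥0∞) ^ (((∑ i, k i : ℕ) : ℝ) * (1 / p.toReal)) * eLpNorm g p volume := by
  obtain ⟨η, hη0, hη⟩ := exists_schwartz_fourier_support (d := d)
    (U := Metric.ball 0 (1 / 2)) Metric.isOpen_ball ⟨0, by simp⟩
  obtain ⟨K, hK⟩ := exists_schwartz_fourier_eq_one (d := d) d
  have hη0' : ‖η 0‖ₑ ≠ 0 := by simpa using hη0
  set B := eLpNorm η ⊤ volume with hB
  refine ⟨‖η 0‖ₑ⁻¹ * (nikolskiiConst p K * B), ?_, fun k f g hg => ?_⟩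
  · exact ENNReal.mul_ne_top (by simpa using hη0)
      (ENNReal.mul_ne_top (nikolskiiConst_ne_top p K) (eLpNorm_schwartz_ne_top η ⊤))
  set W := (2 : ℝ≥0∞) ^ (((∑ i, k i : ℕ) : ℝ) * (1 / p.toReal)) with hW
  set A := W * nikolskiiConst p K * (B * eLpNorm g p volume) with hA
  -- The function `g` itself need not be integrable, but `E l * g` is. The cut-offs `η(2^{-l} x)`
  -- share the sup norm `B`, their spectra stay in the ball of radius `1/2`, and they tend pointwise
  -- to `η 0 ≠ 0`, so a bound uniform in `l` passes to `g`.
  let E (l : ℕ) : 𝓢(Rd d, ℂ) := dilS (fun _ => -(l : ℤ)) η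
  have hbound (l : ℕ) : eLpNorm (fun x => E l x * g x) ⊤ volume ≤ A := by
    have hE (y : Rd d) (hy : 𝓕 (E l) y ≠ 0) : ‖y‖ < 1 / 2 := by
      rw [fourier_dilS] at hy
      have h1 := hη _ (right_ne_zero_of_smul hy)
      have h2 : dil (-fun _ => -(l : ℤ)) y = (2 : ℝ) ^ l • y := by
        ext i; simp
      rw [h2, mem_ball_zero_iff, norm_smul, norm_pow, Real.norm_ofNat] at h1
      have : (1 : ℝ) ≤ 2 ^ l := one_le_pow₀ one_le_two
      nlinarith [norm_nonneg y]
    have h1 := eLpNorm_top_le_nikolskii (hg.2 (E l)).1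
      (ae_eq_integral_mul_of_block hϕ hE hK k hg) hp
    have h2 : eLpNorm (fun x => E l x * g x) p volume ≤ B * eLpNorm g p volume := by
      have h3 := eLpNorm_smul_le_eLpNorm_top_mul_eLpNorm p (μ := volume) hg.1 (E l : Rd d → ℂ)
      have h4 : eLpNorm (E l) ⊤ volume = B := by
        rw [eLpNorm_dilS]; simp [hB]
      rw [h4] at h3
      exact h3
    have h3 := nikolskiiConst_dilS hp hpt K (fun i => (k i : ℤ))
    have h4 : (2 : ℝ≥0∞) ^ (((∑ i, (k i : ℤ) : ℤ) : ℝ) * (1 / p.toReal)) = W := by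
      rw [hW]; push_cast; rfl
    rw [h4] at h3
    rw [h3] at h1
    exact h1.trans (by rw [hA]; gcongr)
  have hae : ∀ᵐ y ∂(volume : Measure (Rd d)), ‖η 0‖ₑ * ‖g y‖ₑ ≤ A := by
    have : ∀ᵐ y ∂(volume : Measure (Rd d)), ∀ l, ‖E l y * g y‖ₑ ≤ A := by
      refine ae_all_iff.mpr fun l => ?_
      filter_upwards [ae_le_eLpNormEssSup (f := fun x => E l x * g x) (μ := volume)] with y hy
      refine hy.trans ?_
      rw [← eLpNorm_exponent_top]
      exact hbound l
    filter_upwards [this] with y hy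
    have hlim : Tendsto (fun l : ℕ => ‖E l y * g y‖ₑ) atTop (𝓝 ‖η 0 * g y‖ₑ) := by
      have h1 : Tendsto (fun l : ℕ => ((2 : ℝ)⁻¹ ^ l) • y) atTop (𝓝 ((0 : ℝ) • y)) :=
        (tendsto_pow_atTop_nhds_zero_of_lt_one (by norm_num) (by norm_num)).smul_const y
      rw [zero_smul] at h1
      have h2 : Tendsto (fun l : ℕ => E l y) atTop (𝓝 (η 0)) := by
        refine ((η.continuous.tendsto 0).comp h1).congr fun l => ?_
        simp [E, dil_const]
      exact (h2.mul_const (g y)).enorm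
    rw [← enorm_mul]
    exact le_of_tendsto hlim (.of_forall hy)
  rw [eLpNorm_exponent_top]
  refine (eLpNormEssSup_le_of_ae_enorm_bound (C := ‖η 0‖ₑ⁻¹ * A) ?_).trans (le_of_eq ?_)
  · filter_upwards [hae] with y hy
    calc ‖g y‖ₑ = ‖η 0‖ₑ⁻¹ * (‖η 0‖ₑ * ‖g y‖ₑ) := by
          rw [← mul_assoc, ENNReal.inv_mul_cancel hη0' enorm_ne_top, one_mul]
      _ ≤ _ := by gcongr
  · rw [hA]; ring

/-- The Nikolskii inequality for the building blocks of the spaces of dominating mixed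
smoothness. -/
theorem exists_distLpNorm_block_le {ϕ : ℝ → ℂ} (hϕ : IsUnivGenerator ϕ) {p s : ℝ≥0∞}
    (hp : p ≠ 0) (hps : p ≤ s) :
    ∃ C : ℝ≥0∞, C ≠ ⊤ ∧ ∀ (k : Fin d → ℕ) (f : 𝓢'(Rd d, ℂ)),
      distLpNorm s (block (dyadicTensor ϕ k) f) ≤
        C * (2 : ℝ≥0∞) ^ (((∑ i, k i : ℕ) : ℝ) * (1 / p.toReal - 1 / s.toReal)) *
          distLpNorm p (block (dyadicTensor ϕ k) f) := by
  by_cases hpt : p = ⊤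
  · subst hpt
    obtain rfl := top_le_iff.mp hps
    exact ⟨1, ENNReal.one_ne_top, fun k f => by simp⟩
  have hp' := ENNReal.toReal_pos hp hpt
  obtain ⟨C, hC, H⟩ := exists_eLpNorm_top_le_of_block (d := d) hϕ hp hpt
  have hr : 0 ≤ 1 - p.toReal / s.toReal := by
    by_cases hs : s = ⊤
    · simp [hs]
    · rw [sub_nonneg]
      exact div_le_one_of_le₀ (ENNReal.toReal_mono hs hps) ENNReal.toReal_nonneg
  -- Adding 1 keeps the constant nonzero, so that the right-hand side is `∞` whenever the `L_p`
  -- quasi-norm is.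
  refine ⟨(C + 1) ^ (1 - p.toReal / s.toReal),
    ENNReal.rpow_ne_top_of_nonneg hr (by simpa using hC), fun k f => ?_⟩
  have hne : (C + 1) ^ (1 - p.toReal / s.toReal) *
      (2 : ℝ≥0∞) ^ (((∑ i, k i : ℕ) : ℝ) * (1 / p.toReal - 1 / s.toReal)) ≠ 0 := by
    refine mul_ne_zero ?_ ?_
    · simp [ENNReal.rpow_eq_zero_iff, hr.not_gt]
    · simp [ENNReal.rpow_eq_zero_iff]
  by_cases hT : ∃ g, IsGivenBy (block (dyadicTensor ϕ k) f) g
  swap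
  · have : distLpNorm p (block (dyadicTensor ϕ k) f) = ⊤ := by
      push Not at hT
      simp [distLpNorm, hT]
    rw [this, ENNReal.mul_top hne]
    exact le_top
  obtain ⟨g, hg⟩ := hT
  rw [hg.distLpNorm_eq, hg.distLpNorm_eq]
  by_cases hN : eLpNorm g p volume = ⊤
  · rw [hN, ENNReal.mul_top hne]
    exact le_top
  have hM := H k f g hg
  by_cases hs : s = ⊤
  · subst hs
    simp only [ENNReal.toReal_top, div_zero, sub_zero, ENNReal.rpow_one]
    refine hM.trans ?_
    gcongr
    exact le_self_add
  set w : ℝ := ((∑ i, k i : ℕ) : ℝ)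
  have hMt : eLpNorm g ⊤ volume ≠ ⊤ :=
    ne_top_of_le_ne_top (ENNReal.mul_ne_top (ENNReal.mul_ne_top hC (by simp)) hN) hM
  have hs' : 0 < s.toReal := hp'.trans_le (ENNReal.toReal_mono hs hps)
  calc eLpNorm g s volume
      ≤ eLpNorm g ⊤ volume ^ (1 - p.toReal / s.toReal) *
          eLpNorm g p volume ^ (p.toReal / s.toReal) := eLpNorm_le_top_interp g hp hps hs hMt
    _ ≤ ((C + 1) * (2 : ℝ≥0∞) ^ (w * (1 / p.toReal)) * eLpNorm g p volume) ^
          (1 - p.toReal / s.toReal) * eLpNorm g p volume ^ (p.toReal / s.toReal) := by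
      gcongr
      refine hM.trans ?_
      gcongr
      exact le_self_add
    _ = (C + 1) ^ (1 - p.toReal / s.toReal) *
          (2 : ℝ≥0∞) ^ (w * (1 / p.toReal) * (1 - p.toReal / s.toReal)) *
          (eLpNorm g p volume ^ (1 - p.toReal / s.toReal) *
            eLpNorm g p volume ^ (p.toReal / s.toReal)) := by
      rw [ENNReal.mul_rpow_of_nonneg _ _ hr, ENNReal.mul_rpow_of_nonneg _ _ hr, ← ENNReal.rpow_mul]
      ring
    _ = _ := by
      rw [← ENNReal.rpow_add_of_nonneg _ _ hr (by positivity), sub_add_cancel, ENNReal.rpow_one]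
      congr 3
      field_simp

/-! ### Sequence norms and the sufficient conditions. -/

variable {I : Type*}

theorem ellqNorm_mono {q : ℝ≥0∞} {a b : I → ℝ≥0∞} (h : ∀ k, a k ≤ b k) :
    ellqNorm q a ≤ ellqNorm q b := by
  unfold ellqNorm
  split_ifs
  · exact iSup_mono h
  · gcongr with k
    exact h k

theorem ellqNorm_mul_left {q : ℝ≥0∞} (hq : q ≠ 0) (c : ℝ≥0∞) (a : I → ℝ≥0∞) :
    ellqNorm q (fun k => c * a k) = c * ellqNorm q a := by
  unfold ellqNorm
  split_ifs with h
  · rw [ENNReal.mul_iSup]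
  · have hq' := ENNReal.toReal_pos hq h
    simp_rw [ENNReal.mul_rpow_of_nonneg _ _ hq'.le]
    rw [ENNReal.tsum_mul_left, ENNReal.mul_rpow_of_nonneg _ _ (by positivity), ← ENNReal.rpow_mul,
      mul_one_div_cancel hq'.ne', ENNReal.rpow_one]

theorem le_ellqNorm {q : ℝ≥0∞} (hq : q ≠ 0) (a : I → ℝ≥0∞) (k : I) : a k ≤ ellqNorm q a := by
  unfold ellqNorm
  split_ifs with h
  · exact le_iSup a k
  · have hq' := ENNReal.toReal_pos hq h
    calc a k = (a k ^ q.toReal) ^ (1 / q.toReal) := by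
          rw [← ENNReal.rpow_mul, mul_one_div_cancel hq'.ne', ENNReal.rpow_one]
      _ ≤ _ := by
        gcongr
        exact ENNReal.le_tsum k

/-- With `A` the `ℓ_q` norm, each `a k ≤ A`, hence `a k ^ s ≤ A ^ (s - q) * a k ^ q`; sum over `k`.
-/
theorem ellqNorm_anti {q s : ℝ≥0∞} (hq : q ≠ 0) (hqs : q ≤ s) (a : I → ℝ≥0∞) :
    ellqNorm s a ≤ ellqNorm q a := by
  by_cases hs : s = ⊤
  · conv_lhs => rw [ellqNorm, if_pos hs]
    exact iSup_le (le_ellqNorm hq a)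
  have hqt : q ≠ ⊤ := ne_top_of_le_ne_top hs hqs
  have hq' := ENNReal.toReal_pos hq hqt
  have hle : q.toReal ≤ s.toReal := ENNReal.toReal_mono hs hqs
  have hs' : 0 < s.toReal := hq'.trans_le hle
  set A := ellqNorm q a with hA
  have hAq : ∑' k, a k ^ q.toReal = A ^ q.toReal := by
    rw [hA, ellqNorm, if_neg hqt, ← ENNReal.rpow_mul, one_div_mul_cancel hq'.ne', ENNReal.rpow_one]
  conv_lhs => rw [ellqNorm, if_neg hs]
  calc (∑' k, a k ^ s.toReal) ^ (1 / s.toReal)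
      ≤ (∑' k, A ^ (s.toReal - q.toReal) * a k ^ q.toReal) ^ (1 / s.toReal) := by
        gcongr with k
        calc a k ^ s.toReal = a k ^ (s.toReal - q.toReal) * a k ^ q.toReal := by
              rw [← ENNReal.rpow_add_of_nonneg _ _ (by linarith) hq'.le, sub_add_cancel]
          _ ≤ _ := by
            gcongr
            exact le_ellqNorm hq a k
    _ = (A ^ s.toReal) ^ (1 / s.toReal) := by
        rw [ENNReal.tsum_mul_left, hAq, ← ENNReal.rpow_add_of_nonneg _ _ (by linarith) hq'.le,
          sub_add_cancel]
    _ = A := by rw [← ENNReal.rpow_mul, mul_one_div_cancel hs'.ne', ENNReal.rpow_one]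

theorem tsum_pow_sum (r : ℝ≥0∞) (d : ℕ) :
    ∑' k : Fin d → ℕ, r ^ (∑ i, k i) = (∑' j : ℕ, r ^ j) ^ d := by
  induction d with
  | zero => simp
  | succ d ih =>
    have h (x : ℕ × (Fin d → ℕ)) : r ^ (∑ i, Fin.consEquiv (fun _ : Fin (d + 1) => ℕ) x i) =
        r ^ x.1 * r ^ (∑ i, x.2 i) := by
      rw [Fin.sum_univ_succ, pow_add]
      rfl
    rw [← (Fin.consEquiv fun _ : Fin (d + 1) => ℕ).tsum_eq]
    simp_rw [h]
    rw [ENNReal.tsum_prod (f := fun a (b : Fin d → ℕ) => r ^ a * r ^ (∑ i, b i))]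
    simp_rw [ENNReal.tsum_mul_left, ENNReal.tsum_mul_right]
    rw [ih, pow_succ, mul_comm]

theorem ellqNorm_geometric_ne_top {q : ℝ≥0∞} (hq : q ≠ 0) {δ : ℝ} (hδ : 0 < δ) :
    ellqNorm q (fun k : Fin d → ℕ => (2 : ℝ≥0∞) ^ (-((∑ i, k i : ℕ) : ℝ) * δ)) ≠ ⊤ := by
  unfold ellqNorm
  split_ifs with h
  · refine ne_top_of_le_ne_top ENNReal.one_ne_top (iSup_le fun k => ?_)
    rw [← ENNReal.rpow_zero (x := 2)]
    refine ENNReal.rpow_le_rpow_of_exponent_le one_le_two ?_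
    rw [neg_mul, neg_nonpos]
    positivity
  · have hq' := ENNReal.toReal_pos hq h
    refine ENNReal.rpow_ne_top_of_nonneg (by positivity) ?_
    have (k : Fin d → ℕ) : ((2 : ℝ≥0∞) ^ (-((∑ i, k i : ℕ) : ℝ) * δ)) ^ q.toReal =
        ((2 : ℝ≥0∞) ^ (-(δ * q.toReal))) ^ (∑ i, k i) := by
      rw [← ENNReal.rpow_mul, ← ENNReal.rpow_natCast, ← ENNReal.rpow_mul]
      congr 1
      ring
    simp_rw [this]
    rw [tsum_pow_sum, ENNReal.tsum_geometric]
    refine ENNReal.pow_ne_top (ENNReal.inv_ne_top.mpr ?_)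
    rw [Ne, tsub_eq_zero_iff_le, not_le]
    exact ENNReal.rpow_lt_one_of_one_lt_of_neg ENNReal.one_lt_two (by simp; positivity)

/-- The embedding of spaces of dominating mixed smoothness with different metrics. -/
theorem contEmbeds_mixedBesovNorm {ϕ : ℝ → ℂ} (hϕ : IsUnivGenerator ϕ) {p q p₀ q₀ : ℝ≥0∞}
    {t t₀ : ℝ} (hp : p ≠ 0) (hq : q ≠ 0) (hq₀ : q₀ ≠ 0) (hpp : p ≤ p₀)
    (ht : t₀ - 1 / p₀.toReal ≤ t - 1 / p.toReal)
    (hqq : t₀ - 1 / p₀.toReal = t - 1 / p.toReal → q ≤ q₀) :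
    ContEmbeds (mixedBesovNorm (d := d) ϕ t p q) (mixedBesovNorm (d := d) ϕ t₀ p₀ q₀) := by
  suffices H : ∃ C : ℝ≥0, ∀ f : 𝓢'(Rd d, ℂ),
      mixedBesovNorm ϕ t₀ p₀ q₀ f ≤ C * mixedBesovNorm ϕ t p q f by
    obtain ⟨C, hC⟩ := H
    exact ⟨fun f hf => (hC f).trans_lt (ENNReal.mul_lt_top ENNReal.coe_lt_top hf),
      C, fun f _ => hC f⟩
  obtain ⟨C, hC, H⟩ := exists_distLpNorm_block_le (d := d) hϕ hp hpp
  set δ := (t - 1 / p.toReal) - (t₀ - 1 / p₀.toReal) with hδ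
  have hblock (f : 𝓢'(Rd d, ℂ)) (k : Fin d → ℕ) :
      (2 : ℝ≥0∞) ^ (((∑ i, k i : ℕ) : ℝ) * t₀) * distLpNorm p₀ (block (dyadicTensor ϕ k) f) ≤
      C * ((2 : ℝ≥0∞) ^ (-((∑ i, k i : ℕ) : ℝ) * δ) *
        ((2 : ℝ≥0∞) ^ (((∑ i, k i : ℕ) : ℝ) * t) *
          distLpNorm p (block (dyadicTensor ϕ k) f))) := by
    set w : ℝ := ((∑ i, k i : ℕ) : ℝ)
    refine (mul_le_mul_right (H k f) _).trans (le_of_eq ?_)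
    rw [← mul_assoc ((2 : ℝ≥0∞) ^ (-w * δ)), ← ENNReal.rpow_add _ _ two_ne_zero ENNReal.ofNat_ne_top,
      ← mul_assoc, mul_left_comm, ← ENNReal.rpow_add _ _ two_ne_zero ENNReal.ofNat_ne_top,
      mul_assoc]
    congr 3
    rw [hδ]; ring
  rcases ht.lt_or_eq with hlt | heq
  -- The factor `2^{-|k|δ}` lies in every `ℓ_{q₀}`, so a bound on the supremum of the weighted
  -- blocks is enough, and `q` and `q₀` are unrelated.
  · have hδ' : 0 < δ := by rw [hδ]; linarith
    set G := ellqNorm q₀ (fun k : Fin d → ℕ => (2 : ℝ≥0∞) ^ (-((∑ i, k i : ℕ) : ℝ) * δ)) with hG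
    have hGt : G ≠ ⊤ := ellqNorm_geometric_ne_top hq₀ hδ'
    refine ⟨(C * G).toNNReal, fun f => ?_⟩
    rw [ENNReal.coe_toNNReal (ENNReal.mul_ne_top hC hGt)]
    calc mixedBesovNorm ϕ t₀ p₀ q₀ f
        ≤ ellqNorm q₀ fun k : Fin d → ℕ => (C * mixedBesovNorm ϕ t p q f) *
            (2 : ℝ≥0∞) ^ (-((∑ i, k i : ℕ) : ℝ) * δ) := by
          refine ellqNorm_mono fun k => (hblock f k).trans ?_
          rw [mul_assoc C, mul_comm (mixedBesovNorm ϕ t p q f)]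
          gcongr
          exact le_ellqNorm hq _ k
      _ = _ := by rw [ellqNorm_mul_left hq₀, ← hG]; ring
  -- No decay is left, and the monotonicity of the sequence norms must be used.
  · have hδ' : δ = 0 := by rw [hδ]; linarith
    refine ⟨C.toNNReal, fun f => ?_⟩
    rw [ENNReal.coe_toNNReal hC]
    calc mixedBesovNorm ϕ t₀ p₀ q₀ f
        ≤ ellqNorm q₀ fun k : Fin d → ℕ => C * ((2 : ℝ≥0∞) ^ (((∑ i, k i : ℕ) : ℝ) * t) *
            distLpNorm p (block (dyadicTensor ϕ k) f)) := by
          refine ellqNorm_mono fun k => (hblock f k).trans (le_of_eq ?_)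
          rw [hδ', mul_zero, ENNReal.rpow_zero, one_mul]
      _ = C * ellqNorm q₀ fun k : Fin d → ℕ => (2 : ℝ≥0∞) ^ (((∑ i, k i : ℕ) : ℝ) * t) *
            distLpNorm p (block (dyadicTensor ϕ k) f) := ellqNorm_mul_left hq₀ _ _
      _ ≤ C * mixedBesovNorm ϕ t p q f := by
          gcongr
          exact ellqNorm_anti hq (hqq heq) _

/-! ### Exact quasi-norms of sums with one term per block. -/

theorem ellqNorm_ite_mem [DecidableEq I] (q : ℝ≥0∞) (hq : q ≠ 0) (s : Finset I) (hs : s.Nonempty)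
    (A : ℝ≥0∞) :
    ellqNorm q (fun k => if k ∈ s then A else 0) = (s.card : ℝ≥0∞) ^ (1 / q.toReal) * A := by
  unfold ellqNorm
  split_ifs with h
  · subst h
    obtain ⟨k, hk⟩ := hs
    simp only [ENNReal.toReal_top, div_zero, ENNReal.rpow_zero, one_mul]
    refine le_antisymm (iSup_le fun k => by split_ifs <;> simp) ?_
    exact le_iSup_of_le k (by simp [hk])
  · have hq' := ENNReal.toReal_pos hq h
    have (k : I) : (if k ∈ s then A else 0) ^ q.toReal = if k ∈ s then A ^ q.toReal else 0 := by
      split_ifs <;> simp [hq']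
    simp_rw [this]
    rw [tsum_eq_sum (s := s) (fun k hk => by simp [hk]), Finset.sum_ite_mem, Finset.inter_self,
      Finset.sum_const, nsmul_eq_mul, ENNReal.mul_rpow_of_nonneg _ _ (by positivity),
      ← ENNReal.rpow_mul, mul_one_div_cancel hq'.ne', ENNReal.rpow_one]

/-- The quasi-norm of a sum of Schwartz functions each of which lives in a single block, all
contributing equally. -/
theorem ellqNorm_block_sum [DecidableEq I] {m : I → Rd d → ℂ}
    (hm : ∀ k, (symb (m k)).HasTemperateGrowth) (w : I → ℝ≥0∞) {J : Finset ℕ} (hJ : J.Nonempty)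
    {n : ℕ → I} (hn : InjOn n J) {S : ℕ → 𝓢(Rd d, ℂ)}
    (hS : ∀ j ∈ J, ∀ ξ, 𝓕 (S j) ξ ≠ 0 → ∀ k, symb (m k) ξ = if k = n j then 1 else 0)
    {p q A : ℝ≥0∞} (hq : q ≠ 0) (hA : ∀ j ∈ J, w (n j) * eLpNorm (S j) p volume = A) :
    ellqNorm q (fun k => w k * distLpNorm p (block (m k) (∑ j ∈ J, (S j : 𝓢'(Rd d, ℂ))))) =
      (J.card : ℝ≥0∞) ^ (1 / q.toReal) * A := by
  have hb (k : I) : block (m k) (∑ j ∈ J, (S j : 𝓢'(Rd d, ℂ))) =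
      ∑ j ∈ J, (((if k = n j then (1 : ℂ) else 0) • S j : 𝓢(Rd d, ℂ)) : 𝓢'(Rd d, ℂ)) := by
    change TemperedDistribution.fourierMultiplierCLM ℂ (symb (m k)) _ = _
    rw [map_sum]
    exact Finset.sum_congr rfl fun j hj => block_coe (hm k) fun ξ hξ => hS j hj ξ hξ k
  have hval (k : I) : w k * distLpNorm p (block (m k) (∑ j ∈ J, (S j : 𝓢'(Rd d, ℂ)))) =
      if k ∈ J.image n then A else 0 := by
    rw [hb]
    split_ifs with hk
    · obtain ⟨j, hj, rfl⟩ := Finset.mem_image.mp hk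
      rw [Finset.sum_eq_single_of_mem j hj, if_pos rfl, one_smul, distLpNorm_coe, hA j hj]
      intro i hi hij
      rw [if_neg fun h => hij (hn hi hj h.symm), zero_smul, map_zero]
    · rw [Finset.sum_eq_zero, distLpNorm_zero, mul_zero]
      intro j hj
      rw [if_neg fun h => hk (Finset.mem_image.mpr ⟨j, hj, h.symm⟩), zero_smul, map_zero]
  simp_rw [hval]
  rw [ellqNorm_ite_mem q hq _ (hJ.image n), Finset.card_image_of_injOn hn]

theorem isoBesovNorm_sum {φ : Rd d → ℝ} (hφ : IsIsoGenerator φ) (t : ℝ) {J : Finset ℕ}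
    (hJ : J.Nonempty) {S : ℕ → 𝓢(Rd d, ℂ)}
    (hS : ∀ j ∈ J, ∀ ξ, 𝓕 (S j) ξ ≠ 0 → ‖(-(2 * Real.pi)) • ξ‖ ≤ 2 ^ j ∧
      (j = 0 ∨ 3 / 4 * 2 ^ j < ‖(-(2 * Real.pi)) • ξ‖))
    {p q A : ℝ≥0∞} (hq : q ≠ 0)
    (hA : ∀ j ∈ J, (2 : ℝ≥0∞) ^ ((j : ℝ) * t) * eLpNorm (S j) p volume = A) :
    isoBesovNorm φ t p q (∑ j ∈ J, (S j : 𝓢'(Rd d, ℂ))) =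
      (J.card : ℝ≥0∞) ^ (1 / q.toReal) * A :=
  ellqNorm_block_sum (n := id) (fun k => hasTemperateGrowth_symb_dyadic hφ k) _ hJ
    Function.injective_id.injOn
    (fun j hj ξ hξ k => dyadic_eq_ite (fun x hx => by simp [hφ.eq_one x hx]) hφ.eq_zero'
      (hS j hj ξ hξ).1 (hS j hj ξ hξ).2 k) hq hA

theorem mixedBesovNorm_sum {ϕ : ℝ → ℂ} (hϕ : IsUnivGenerator ϕ) (t : ℝ) {J : Finset ℕ}
    (hJ : J.Nonempty) {n : ℕ → Fin d → ℕ} (hn : InjOn n J) {S : ℕ → 𝓢(Rd d, ℂ)}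
    (hS : ∀ j ∈ J, ∀ ξ, 𝓕 (S j) ξ ≠ 0 → ∀ i, |((-(2 * Real.pi)) • ξ) i| ≤ 2 ^ n j i ∧
      (n j i = 0 ∨ 3 / 4 * 2 ^ n j i < |((-(2 * Real.pi)) • ξ) i|))
    {p q A : ℝ≥0∞} (hq : q ≠ 0)
    (hA : ∀ j ∈ J, (2 : ℝ≥0∞) ^ (((∑ i, n j i : ℕ) : ℝ) * t) * eLpNorm (S j) p volume = A) :
    mixedBesovNorm ϕ t p q (∑ j ∈ J, (S j : 𝓢'(Rd d, ℂ))) =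
      (J.card : ℝ≥0∞) ^ (1 / q.toReal) * A :=
  ellqNorm_block_sum (fun k => hasTemperateGrowth_symb_dyadicTensor hϕ k) _ hJ hn
    (fun j hj ξ hξ k => dyadicTensor_eq_ite hϕ (fun i => (hS j hj ξ hξ i).1)
      (fun i => (hS j hj ξ hξ i).2) k) hq hA

/-! ### Necessary conditions from test functions. -/

theorem nonpos_of_two_rpow_mul_le {x : ℝ} {b A : ℝ≥0∞} (hb : b ≠ 0) (hA : A ≠ ⊤) {l₀ : ℕ}
    (h : ∀ l ≥ l₀, (2 : ℝ≥0∞) ^ ((l : ℝ) * x) * b ≤ A) : x ≤ 0 := by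
  by_contra! hx
  have h1 : Tendsto (fun l : ℕ => ((2 : ℝ≥0∞) ^ x) ^ l) atTop (𝓝 ⊤) :=
    ENNReal.tendsto_pow_atTop_nhds_top_iff.mpr (ENNReal.one_lt_rpow ENNReal.one_lt_two hx)
  have h2 : A / b < ⊤ := ENNReal.div_lt_top hA hb
  obtain ⟨l, hl, hl'⟩ := ((h1.eventually (lt_mem_nhds h2)).and (eventually_ge_atTop l₀)).exists
  have h3 := h l hl'
  rw [mul_comm (l : ℝ), ENNReal.rpow_mul, ENNReal.rpow_natCast] at h3
  refine hl.not_ge ?_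
  rw [ENNReal.le_div_iff_mul_le (.inl hb) (.inr hA)]
  exact h3

/-- The shifts of the dyadic levels of the coordinates relative to that of the norm in
`goodRegion`. -/
def shift (d : ℕ) (i : Fin d) : ℕ := if (i : ℕ) = 0 then 0 else d + 4

theorem shift_le (i : Fin d) : shift d i ≤ d + 4 := by
  unfold shift; split_ifs <;> lia

/-- A frequency region lying in one isotropic and one mixed block. -/
def goodRegion (d : ℕ) : Set (Rd d) :=
  {x | (3 / 4 < ‖x‖ ∧ ‖x‖ < 1) ∧
    ∀ i, 3 / 4 * (2 ^ shift d i)⁻¹ < |x i| ∧ |x i| < (2 ^ shift d i)⁻¹}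

theorem isOpen_goodRegion : IsOpen (goodRegion d) := by
  have h0 : IsOpen {x : Rd d | 3 / 4 < ‖x‖ ∧ ‖x‖ < 1} :=
    (isOpen_lt continuous_const continuous_norm).inter (isOpen_lt continuous_norm continuous_const)
  have hi (i : Fin d) :
      IsOpen {x : Rd d | 3 / 4 * (2 ^ shift d i)⁻¹ < |x i| ∧ |x i| < (2 ^ shift d i)⁻¹} := by
    have hc : Continuous fun x : Rd d => |x i| := by fun_prop
    exact (isOpen_lt continuous_const hc).inter (isOpen_lt hc continuous_const)
  convert h0.inter (isOpen_iInter_of_finite hi) using 1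
  ext x
  simp [goodRegion]

/-- One coordinate is `7/8`. The others are `(7/8) 2^{-(d+4)}` and together add at most
`(7/8)(1/16)`, so the norm stays between `3/4` and `1` although every coordinate lies in its dyadic
shell. This is the reason for the shift `d + 4`. -/
theorem goodRegion_nonempty (hd : 1 ≤ d) : (goodRegion d).Nonempty := by
  let v : Rd d := WithLp.toLp 2 fun i => 7 / 8 * (2 ^ shift d i)⁻¹
  have habs (i : Fin d) : |v i| = 7 / 8 * (2 ^ shift d i)⁻¹ := abs_of_pos (by positivity)
  refine ⟨v, ⟨?_, ?_⟩, fun i => ?_⟩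
  · have h1 := PiLp.norm_apply_le v (⟨0, hd⟩ : Fin d)
    rw [Real.norm_eq_abs, habs] at h1
    simp only [shift, if_true, pow_zero, inv_one, mul_one] at h1
    linarith
  · refine (norm_le_sum_abs v).trans_lt ?_
    have h1 (i : Fin d) : |v i| ≤ (if i = (⟨0, hd⟩ : Fin d) then 7 / 8 else 0) +
        7 / 8 * ((2 : ℝ) ^ (d + 4))⁻¹ := by
      rw [habs, shift]
      by_cases hi : (i : ℕ) = 0
      · rw [if_pos hi, if_pos (Fin.ext hi)]
        have : (0 : ℝ) < 7 / 8 * (2 ^ (d + 4))⁻¹ := by positivity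
        norm_num at this ⊢
      · rw [if_neg hi, if_neg fun h => hi (congrArg Fin.val h), zero_add]
    refine (Finset.sum_le_sum fun i _ => h1 i).trans_lt ?_
    rw [Finset.sum_add_distrib, Finset.sum_ite_eq' Finset.univ, if_pos (Finset.mem_univ _),
      Finset.sum_const, Finset.card_univ, Fintype.card_fin, nsmul_eq_mul]
    have h2 : (d : ℝ) ≤ 2 ^ d := by exact_mod_cast Nat.lt_two_pow_self.le
    have h3 : (d : ℝ) * ((2 : ℝ) ^ (d + 4))⁻¹ ≤ 1 / 16 := by
      rw [← div_eq_mul_inv, div_le_iff₀ (by positivity), pow_add]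
      linarith
    linarith
  · rw [habs]
    have : (0 : ℝ) < (2 ^ shift d i)⁻¹ := by positivity
    constructor <;> linarith

theorem eLpNorm_smul_dilS_const (τ : ℝ) (j : ℕ) (S : 𝓢(Rd d, ℂ)) (p : ℝ≥0∞) :
    eLpNorm ((((2 : ℝ) ^ (-(j * d * τ)) : ℝ) : ℂ) • dilS (fun _ => (j : ℤ)) S : 𝓢(Rd d, ℂ)) p volume
      = (2 : ℝ≥0∞) ^ (-(j * d * (τ + 1 / p.toReal)) : ℝ) * eLpNorm S p volume := by
  have hc : ‖(((2 : ℝ) ^ (-(j * d * τ)) : ℝ) : ℂ)‖ₑ = (2 : ℝ≥0∞) ^ (-(j * d * τ) : ℝ) := by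
    rw [← ofReal_norm, Complex.norm_real, Real.norm_of_nonneg (by positivity),
      ← ENNReal.ofReal_rpow_of_pos two_pos]
    simp
  change eLpNorm ((((2 : ℝ) ^ (-(j * d * τ)) : ℝ) : ℂ) • (dilS (fun _ => (j : ℤ)) S : Rd d → ℂ))
    p volume = _
  rw [eLpNorm_const_smul, eLpNorm_dilS, hc, ← mul_assoc,
    ← ENNReal.rpow_add _ _ two_ne_zero ENNReal.ofNat_ne_top]
  congr 2
  simp
  ring

/-- Lacunary sums of dilates of one function, as test functions for the embedding of an isotropic
space into a space of dominating mixed smoothness. -/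
theorem exists_lacunary_estimate (hd : 1 ≤ d) {φ : Rd d → ℝ} (hφ : IsIsoGenerator φ) {ϕ : ℝ → ℂ}
    (hϕ : IsUnivGenerator ϕ) {p q p₀ q₀ : ℝ≥0∞} {t t₀ : ℝ} (hq : q ≠ 0)
    (hp₀ : p₀ ≠ 0) (hq₀ : q₀ ≠ 0)
    (hemb : ContEmbeds (isoBesovNorm φ (t * d) p q) (mixedBesovNorm (d := d) ϕ t₀ p₀ q₀)) :
    ∃ A b : ℝ≥0∞, A ≠ ⊤ ∧ b ≠ 0 ∧ ∀ J : Finset ℕ, J.Nonempty → (∀ j ∈ J, d + 4 ≤ j) → ∀ B : ℝ≥0∞,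
      (∀ j ∈ J, (2 : ℝ≥0∞) ^ ((j : ℝ) * (d * ((t₀ - 1 / p₀.toReal) - (t - 1 / p.toReal)))) = B) →
      (J.card : ℝ≥0∞) ^ (1 / q₀.toReal) * (B * b) ≤ (J.card : ℝ≥0∞) ^ (1 / q.toReal) * A := by
  obtain ⟨C, hC⟩ := hemb.2
  let V : Set (Rd d) := (fun ξ => (-(2 * Real.pi)) • ξ) ⁻¹' goodRegion d
  have hV : IsOpen V := isOpen_goodRegion.preimage (by fun_prop)
  have hVne : V.Nonempty := by
    obtain ⟨x, hx⟩ := goodRegion_nonempty hd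
    refine ⟨(-(2 * Real.pi))⁻¹ • x, ?_⟩
    change (-(2 * Real.pi)) • (-(2 * Real.pi))⁻¹ • x ∈ goodRegion d
    rwa [smul_inv_smul₀ (by simp [Real.pi_ne_zero])]
  obtain ⟨S, hS0, hS⟩ := exists_schwartz_fourier_support hV hVne
  -- The amplitude `2^{-jdτ}` makes every isotropic term `2^{jtd} ‖S_j‖_p` equal to `‖S‖_p`.
  let τ := t - 1 / p.toReal
  let Sj (j : ℕ) : 𝓢(Rd d, ℂ) := (((2 : ℝ) ^ (-(j * d * τ)) : ℝ) : ℂ) • dilS (fun _ => (j : ℤ)) S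
  let n (j : ℕ) (i : Fin d) : ℕ := j - shift d i
  have hspec (j : ℕ) (ξ : Rd d) (hξ : 𝓕 (Sj j) ξ ≠ 0) :
      (2 ^ j : ℝ)⁻¹ • (-(2 * Real.pi)) • ξ ∈ goodRegion d := by
    have h1 : 𝓕 (Sj j) ξ = (((2 : ℝ) ^ (-(j * d * τ)) : ℝ) : ℂ) •
        𝓕 (dilS (fun _ => (j : ℤ)) S) ξ := by
      simp only [Sj, FourierTransform.fourier_smul, smul_apply]
    rw [h1, fourier_dilS] at hξ
    have h2 := hS _ (right_ne_zero_of_smul (right_ne_zero_of_smul hξ))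
    have h3 : dil (-fun _ => (j : ℤ)) ξ = (2 ^ j : ℝ)⁻¹ • ξ := by
      ext i; simp [zpow_neg]
    rw [h3] at h2
    rwa [smul_comm]
  -- The first factor is the weight lost because the mixed level is `jd` minus the sum of the
  -- shifts.
  set b := (2 : ℝ≥0∞) ^ (-(∑ i, (shift d i : ℝ)) * t₀) * eLpNorm S p₀ volume with hb
  refine ⟨C * eLpNorm S p volume, b, ENNReal.mul_ne_top ENNReal.coe_ne_top
    (eLpNorm_schwartz_ne_top S p), mul_ne_zero (by simp [ENNReal.rpow_eq_zero_iff])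
    (eLpNorm_schwartz_ne_zero hS0 hp₀), fun J hJ hJd B hB => ?_⟩
  have hiso : isoBesovNorm φ (t * d) p q (∑ j ∈ J, (Sj j : 𝓢'(Rd d, ℂ))) =
      (J.card : ℝ≥0∞) ^ (1 / q.toReal) * eLpNorm S p volume := by
    refine isoBesovNorm_sum hφ _ hJ (fun j hj ξ hξ => ?_) hq fun j hj => ?_
    · obtain ⟨⟨h1, h2⟩, -⟩ := hspec j ξ hξ
      rw [norm_smul, norm_inv, norm_pow, Real.norm_ofNat, ← div_eq_inv_mul] at h1 h2
      rw [lt_div_iff₀ (by positivity)] at h1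
      rw [div_lt_one (by positivity)] at h2
      exact ⟨h2.le, .inr h1⟩
    · rw [eLpNorm_smul_dilS_const, ← mul_assoc,
        ← ENNReal.rpow_add _ _ two_ne_zero ENNReal.ofNat_ne_top]
      have : (j : ℝ) * (t * d) + -(j * d * (τ + 1 / p.toReal)) = 0 := by simp only [τ]; ring
      rw [this, ENNReal.rpow_zero, one_mul]
  have hmix : mixedBesovNorm ϕ t₀ p₀ q₀ (∑ j ∈ J, (Sj j : 𝓢'(Rd d, ℂ))) =
      (J.card : ℝ≥0∞) ^ (1 / q₀.toReal) * (B * b) := by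
    refine mixedBesovNorm_sum hϕ _ hJ (n := n) (fun i hi j hj hij => ?_)
      (fun j hj ξ hξ i => ?_) hq₀ fun j hj => ?_
    -- The coordinate of index 0 is not shifted, so the level `j` can be read off from it.
    · simpa [n, shift] using congrFun hij ⟨0, hd⟩
    · obtain ⟨h1, h2⟩ := (hspec j ξ hξ).2 i
      have hle : shift d i ≤ j := (shift_le i).trans (hJd j hj)
      have hn : (2 : ℝ) ^ n j i = 2 ^ j * (2 ^ shift d i)⁻¹ := pow_sub₀ _ two_ne_zero hle
      rw [PiLp.smul_apply, smul_eq_mul, abs_mul, abs_of_pos (by positivity), ← div_eq_inv_mul]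
        at h1 h2
      rw [lt_div_iff₀ (by positivity)] at h1
      rw [div_lt_iff₀ (by positivity)] at h2
      rw [hn]
      exact ⟨by linarith, .inr (by linarith)⟩
    · have hsum : ((∑ i, n j i : ℕ) : ℝ) = j * d - ∑ i, (shift d i : ℝ) := by
        push_cast
        rw [Finset.sum_congr rfl fun i _ => Nat.cast_sub ((shift_le i).trans (hJd j hj))]
        simp [mul_comm]
      rw [eLpNorm_smul_dilS_const, hsum, ← hB j hj, hb, ← mul_assoc, ← mul_assoc,
        ← ENNReal.rpow_add _ _ two_ne_zero ENNReal.ofNat_ne_top,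
        ← ENNReal.rpow_add _ _ two_ne_zero ENNReal.ofNat_ne_top]
      congr 2
      simp only [τ]; ring
  have hfin : (∑ j ∈ J, (Sj j : 𝓢'(Rd d, ℂ))) ∈ finiteSpace (isoBesovNorm φ (t * d) p q) := by
    rw [finiteSpace, mem_ofPred_eq, hiso]
    exact (ENNReal.mul_ne_top (ENNReal.rpow_ne_top_of_nonneg (by positivity) (by simp))
      (eLpNorm_schwartz_ne_top S p)).lt_top
  have := hC _ hfin
  rw [hiso, hmix] at this
  exact this.trans (le_of_eq (mul_left_comm _ _ _))

/-- Spreading out a low-frequency function: the integrability cannot decrease. -/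
theorem one_div_le_of_contEmbeds (hd : 1 ≤ d) {φ : Rd d → ℝ} (hφ : IsIsoGenerator φ) {ϕ : ℝ → ℂ}
    (hϕ : IsUnivGenerator ϕ) {p q p₀ q₀ : ℝ≥0∞} {t t₀ : ℝ} (hq : q ≠ 0)
    (hp₀ : p₀ ≠ 0) (hq₀ : q₀ ≠ 0)
    (hemb : ContEmbeds (isoBesovNorm φ t p q) (mixedBesovNorm (d := d) ϕ t₀ p₀ q₀)) :
    1 / p₀.toReal ≤ 1 / p.toReal := by
  obtain ⟨C, hC⟩ := hemb.2
  -- As `2π/7 < 1`, the rescaled spectrum lies in the unit ball, where only the zeroth blocks act.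
  obtain ⟨S, hS0, hS⟩ := exists_schwartz_fourier_support (d := d)
    (U := Metric.ball 0 (1 / 7)) Metric.isOpen_ball ⟨0, by simp⟩
  have hd' : (0 : ℝ) < d := by exact_mod_cast hd
  suffices H : ∀ l : ℕ, l ≥ 0 → (2 : ℝ≥0∞) ^ ((l : ℝ) * (d * (1 / p₀.toReal - 1 / p.toReal))) *
      eLpNorm S p₀ volume ≤ C * eLpNorm S p volume by
    have := nonpos_of_two_rpow_mul_le (eLpNorm_schwartz_ne_zero hS0 hp₀)
      (ENNReal.mul_ne_top ENNReal.coe_ne_top (eLpNorm_schwartz_ne_top S p)) H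
    linarith [nonpos_of_mul_nonpos_right this hd']
  intro l _
  -- The index is a dummy: the formulas for sums are applied with `J = {0}`.
  let Sl (_ : ℕ) : 𝓢(Rd d, ℂ) := dilS (fun _ => -(l : ℤ)) S
  have hspec (j : ℕ) (ξ : Rd d) (hξ : 𝓕 (Sl j) ξ ≠ 0) : ‖(-(2 * Real.pi)) • ξ‖ ≤ 1 := by
    rw [fourier_dilS] at hξ
    have h1 := hS _ (right_ne_zero_of_smul hξ)
    have h2 : dil (-fun _ => -(l : ℤ)) ξ = (2 : ℝ) ^ l • ξ := by
      ext i; simp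
    rw [h2, mem_ball_zero_iff, norm_smul, norm_pow, Real.norm_ofNat] at h1
    have h3 : (1 : ℝ) ≤ 2 ^ l := one_le_pow₀ one_le_two
    rw [norm_smul, norm_neg, Real.norm_of_nonneg (by positivity)]
    nlinarith [norm_nonneg ξ, Real.pi_lt_d2]
  have hnorm (s : ℝ≥0∞) : eLpNorm (Sl 0) s volume =
      (2 : ℝ≥0∞) ^ ((l : ℝ) * d * (1 / s.toReal)) * eLpNorm S s volume := by
    rw [eLpNorm_dilS]
    congr 2
    simp [mul_comm]
  have hiso : isoBesovNorm φ t p q (∑ j ∈ {0}, (Sl j : 𝓢'(Rd d, ℂ))) = _ :=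
    isoBesovNorm_sum hφ t (Finset.singleton_nonempty 0) (A := eLpNorm (Sl 0) p volume)
      (fun j hj ξ hξ => by
        obtain rfl := Finset.mem_singleton.mp hj
        exact ⟨(hspec 0 ξ hξ).trans_eq (pow_zero 2).symm, .inl rfl⟩) hq
      fun j hj => by
        obtain rfl := Finset.mem_singleton.mp hj
        simp
  have hmix : mixedBesovNorm ϕ t₀ p₀ q₀ (∑ j ∈ {0}, (Sl j : 𝓢'(Rd d, ℂ))) = _ :=
    mixedBesovNorm_sum hϕ t₀ (Finset.singleton_nonempty 0) (n := fun _ _ => 0)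
      (A := eLpNorm (Sl 0) p₀ volume) (by simp)
      (fun j hj ξ hξ i => by
        refine ⟨?_, .inl rfl⟩
        have := (PiLp.norm_apply_le ((-(2 * Real.pi)) • ξ) i).trans (hspec j ξ hξ)
        rwa [pow_zero]) hq₀
      fun j hj => by
        obtain rfl := Finset.mem_singleton.mp hj
        simp
  simp only [Finset.card_singleton, Nat.cast_one, ENNReal.one_rpow, one_mul] at hiso hmix
  have hfin : (∑ j ∈ {0}, (Sl j : 𝓢'(Rd d, ℂ))) ∈ finiteSpace (isoBesovNorm φ t p q) := by
    rw [finiteSpace, mem_ofPred_eq, hiso]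
    exact (eLpNorm_schwartz_ne_top _ p).lt_top
  have h := hC _ hfin
  rw [hiso, hmix, hnorm, hnorm] at h
  have e : (l : ℝ) * (d * (1 / p₀.toReal - 1 / p.toReal)) =
      -(l * d * (1 / p.toReal)) + l * d * (1 / p₀.toReal) := by ring
  rw [e, ENNReal.rpow_add _ _ two_ne_zero ENNReal.ofNat_ne_top, mul_assoc]
  calc _ ≤ (2 : ℝ≥0∞) ^ (-((l : ℝ) * d * (1 / p.toReal))) *
        (C * ((2 : ℝ≥0∞) ^ ((l : ℝ) * d * (1 / p.toReal)) * eLpNorm S p volume)) := by gcongr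
    _ = _ := by
      rw [mul_left_comm, ← mul_assoc _ _ (eLpNorm S p volume),
        ← ENNReal.rpow_add _ _ two_ne_zero ENNReal.ofNat_ne_top, neg_add_cancel, ENNReal.rpow_zero,
        one_mul]

/-- For nonzero exponents the convention `1 / (⊤ : ℝ≥0∞).toReal = 0` is the correct reciprocal of
`∞`. -/
theorem le_of_one_div_toReal_le {a b : ℝ≥0∞} (ha : a ≠ 0) (hb : b ≠ 0)
    (h : 1 / b.toReal ≤ 1 / a.toReal) : a ≤ b := by
  by_cases hbt : b = ⊤
  · simp [hbt]
  have hb' := ENNReal.toReal_pos hb hbt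
  by_cases hat : a = ⊤
  · rw [hat, ENNReal.toReal_top, div_zero] at h
    exact absurd h (by simpa using hb')
  · exact (ENNReal.toReal_le_toReal hat hbt).mp
      ((one_div_le_one_div hb' (ENNReal.toReal_pos ha hat)).mp h)

end BesovEmb
end

/-! ### Necessary and sufficient conditions combined. -/

theorem theorem3p10 (d : ℕ) (hd : 1 ≤ d)
    (φ : BesovEmb.Rd d → ℝ) (hφ : BesovEmb.IsIsoGenerator φ)
    (ϕ : ℝ → ℂ) (hϕ : BesovEmb.IsUnivGenerator ϕ)
    (p q : ℝ≥0∞) (hp : 0 < p) (hq : 0 < q) (t : ℝ)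
    (p₀ q₀ : ℝ≥0∞) (hp₀ : 0 < p₀) (hq₀ : 0 < q₀) (t₀ : ℝ)
    (hemb : BesovEmb.ContEmbeds (BesovEmb.isoBesovNorm φ (t * d) p q)
      (BesovEmb.mixedBesovNorm (d := d) ϕ t₀ p₀ q₀)) :
    BesovEmb.ContEmbeds (BesovEmb.mixedBesovNorm (d := d) ϕ t p q)
      (BesovEmb.mixedBesovNorm (d := d) ϕ t₀ p₀ q₀) := by
  have hd' : (0 : ℝ) < d := by exact_mod_cast hd
  have hpp := BesovEmb.one_div_le_of_contEmbeds hd hφ hϕ hq.ne' hp₀.ne' hq₀.ne' hemb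
  obtain ⟨A, b, hA, hb, H⟩ :=
    BesovEmb.exists_lacunary_estimate hd hφ hϕ hq.ne' hp₀.ne' hq₀.ne' hemb
  refine BesovEmb.contEmbeds_mixedBesovNorm hϕ hp.ne' hq.ne' hq₀.ne'
    (BesovEmb.le_of_one_div_toReal_le hp.ne' hp₀.ne' hpp) ?_ fun heq => ?_
  -- A single level `l` tending to infinity.
  · have := BesovEmb.nonpos_of_two_rpow_mul_le hb hA (l₀ := d + 4) fun l hl => by
      simpa using H {l} (by simp) (by simpa using hl) _ fun j hj => by
        rw [Finset.mem_singleton.mp hj]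
    linarith [nonpos_of_mul_nonpos_right this hd']
  -- In the equality case all mixed terms agree (`B = 1`). A run of `2^l` levels gives `2^{l/q₀} b ≤
  -- 2^{l/q} A` for all `l`, hence `1/q₀ ≤ 1/q`.
  · refine BesovEmb.le_of_one_div_toReal_le hq.ne' hq₀.ne' ?_
    have := BesovEmb.nonpos_of_two_rpow_mul_le (x := 1 / q₀.toReal - 1 / q.toReal) hb hA (l₀ := 0)
      fun l _ => by
        have h := H (Finset.Ico (d + 4) (d + 4 + 2 ^ l)) (by simp)
          (fun j hj => (Finset.mem_Ico.mp hj).1) 1 fun j _ => by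
            rw [heq, sub_self, mul_zero, mul_zero, ENNReal.rpow_zero]
        rw [Nat.card_Ico, add_tsub_cancel_left, one_mul] at h
        push_cast at h
        rw [← ENNReal.rpow_natCast, ← ENNReal.rpow_mul, ← ENNReal.rpow_mul] at h
        have e : (l : ℝ) * (1 / q₀.toReal - 1 / q.toReal) =
            -(l * (1 / q.toReal)) + l * (1 / q₀.toReal) := by ring
        rw [e, ENNReal.rpow_add _ _ two_ne_zero ENNReal.ofNat_ne_top, mul_assoc]
        refine (mul_le_mul_right h _).trans (le_of_eq ?_)
        rw [← mul_assoc, ← ENNReal.rpow_add _ _ two_ne_zero ENNReal.ofNat_ne_top, neg_add_cancel,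
          ENNReal.rpow_zero, one_mul]
    linarith
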